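/- Let $T\ge 1$, $s\ge 0$, let $N_1,N_2,\dots$ and $K_1,K_2,\dots$ be nonnegative integers, $M_l=\sum_{k=1}^{l}(N_k+K_k)$, and let $S=\bigcup_{l=0}^{s-1}\{M_l,\dots,M_l+N_{l+1}-1\}$ be the set of missing times. Let $\vec a(j)\in\mathbb C^T$ $(j\in S)$ and $A(e^{i\lambda})=\sum_{j\in S}\vec a(j)e^{ij\lambda}$; this is the transfer function of the functional $A_s\vec\zeta=\sum_{j\in S}\vec a(j)^\top\vec\zeta(j)$ of a $T$-variate stationary sequence $\vec\zeta$, which is observed with an uncorrelated stationary noise $\vec\theta$ at the times $j\in\mathbb Z\setminus S$. A spectral density is an integrable function on $(-\pi,\pi]$ (up to a.e. equality) whose values are a.e. Hermitian positive semidefinite complex $T\times T$ matrices. For spectral densities $f,g$ let $L_2(f+g)$ be the space of measurable $h:(-\pi,\pi]\to\mathbb C^T$ with $\int h^\top(f+g)\overline h\,d\lambda<\infty$, let $L_2^{s-}(f+g)$ be its closed subspace generated by the functions $e^{ij\lambda}\delta_\nu$, $j\in\mathbb Z\setminus S$, $1\le\nu\le T$ ($\delta_\nu$ the standard basis of $\mathbb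 C^T$), and let $$\Delta(h;f,g)=\frac1{2\pi}\int_{-\pi}^{\pi}(A-h)^\top f\,\overline{(A-h)}\,d\lambda+\frac1{2\pi}\int_{-\pi}^{\pi}h^\top g\,\overline{h}\,d\lambda\in[0,\infty].$$ The optimal spectral characteristic $h(f,g)$ is a minimizer of $\Delta(\cdot;f,g)$ over $L_2^{s-}(f+g)$, and $\Delta(f,g)$ is the minimal value. Let $D_f,D_g$ be sets of spectral densities, $D=D_f\times D_g$, and let $f^0\in D_f$, $g^0\in D_g$ satisfy the minimality condition: $f^0+g^0$ is invertible a.e. and $\int_{-\pi}^{\pi}\mathrm{Tr}\,[(f^0(\lambda)+g^0(\lambda))^{-1}]\,d\lambda<\infty$. Then $h^0=h(f^0,g^0)$ exists and is unique up to null sets. Consider, on the real Banach space $L_1\times L_1$ of pairs of integrable $T\times T$ matrix functions on $(-\pi,\pi]$, the unconstrained problem $$\Delta_D(f,g)=-\Delta(h^0;f,g)+\delta((f,g)\mid D)\to\inf,$$ where $\delta(\cdot\mid D)$ is $0$ on $D$ and $+\infty$ outside $D$ (and $\Delta_D=+\infty$ outside $D$). Then: (i) $(f^0,g^0)$ is a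 solution of this problem if and only if $0\in\partial\Delta_D(f^0,g^0)$, where $\partial$ is the subdifferential, i.e. the set of continuous linear functionals $u$ on $L_1\times L_1$ with $\Delta_D(f,g)\ge\Delta_D(f^0,g^0)+u((f,g)-(f^0,g^0))$ for all $(f,g)$. (ii) If $(f^0,g^0)$ is a solution of this problem, then $f^0,g^0$ are least favorable in $D$, i.e. $\Delta(f^0,g^0)=\max_{(f,g)\in D}\Delta(f,g)$. If moreover $h^0\in H_D=\bigcap_{(f,g)\in D}L_2^{s-}(f+g)$, then $h^0$ is the minimax spectral characteristic: $\max_{(f,g)\in D}\Delta(h^0;f,g)$ is attained and equals $\min_{h\in H_D}\sup_{(f,g)\in D}\Delta(h;f,g)$. -/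

import Mathlib

open MeasureTheory Set
open scoped ENNReal Matrix ComplexOrder

attribute [local instance] Matrix.normedAddCommGroup Matrix.normedSpace

namespace MinimaxInterpolation

noncomputable section

/-- Lebesgue measure on the frequency interval `(-π, π]`. -/
abbrev freq : Measure ℝ := volume.restrict (Ioc (-Real.pi) Real.pi)

/-- The real Banach space `L₁` of (a.e. classes of) integrable functions on `(-π, π]` with values
in the complex `T × T` matrices. -/
abbrev MatrixL1 (T : ℕ) : Type := Lp (Matrix (Fin T) (Fin T) ℂ) 1 freq

/-- Spectral density matrices (of a `T`-variate stationary sequence): integrable and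
Hermitian positive semidefinite almost everywhere. -/
def IsSpectralDensity {T : ℕ} (f : MatrixL1 T) : Prop :=
  ∀ᵐ x ∂freq, (f x).PosSemidef

/-- `M_l = ∑_{k=0}^{l} (N_k + K_k)`, where `N_0 = K_0 = 0`. -/
def gapStart (N K : ℕ → ℕ) (l : ℕ) : ℕ := ∑ k ∈ Finset.Icc 1 l, (N k + K k)

/-- The set of missing times, the union over `l = 0, …, s - 1` of
`{M_l, …, M_l + N_{l+1} - 1}`. -/
def missing (s : ℕ) (N K : ℕ → ℕ) : Finset ℤ :=
  (Finset.range s).biUnion fun l =>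
    Finset.Ico (gapStart N K l : ℤ) ((gapStart N K l : ℤ) + (N (l + 1) : ℤ))

/-- `A(e^{iλ}) = ∑_{j ∈ S} a(j) e^{ijλ}`. -/
def transferFn {T : ℕ} (S : Finset ℤ) (a : ℤ → Fin T → ℂ) (x : ℝ) : Fin T → ℂ :=
  ∑ j ∈ S, Complex.exp (Complex.I * (j : ℂ) * (x : ℂ)) • a j

/-- `∫ b(λ)ᵀ F(λ) \overline{b(λ)} dλ` over `(-π, π]`, as an element of `[0, ∞]`; the integrand is
real and nonnegative where `F(λ)` is positive semidefinite. -/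
def weightedSq {T : ℕ} (F : ℝ → Matrix (Fin T) (Fin T) ℂ) (b : ℝ → Fin T → ℂ) : ℝ≥0∞ :=
  ∫⁻ x, ENNReal.ofReal (b x ⬝ᵥ (F x *ᵥ star (b x))).re ∂freq

/-- `L₂(F)`, as a set of functions. -/
def L2 {T : ℕ} (F : ℝ → Matrix (Fin T) (Fin T) ℂ) : Set (ℝ → Fin T → ℂ) :=
  {b | AEMeasurable b freq ∧ weightedSq F b < ⊤}

/-- The linear span of the functions `e^{ijλ} δ_ν`, `j ∈ ℤ ∖ S`. -/
def observedSpan (T : ℕ) (S : Finset ℤ) : Submodule ℂ (ℝ → Fin T → ℂ) :=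
  Submodule.span ℂ {b | ∃ j : ℤ, j ∉ S ∧ ∃ ν : Fin T,
    b = fun x : ℝ => Pi.single ν (Complex.exp (Complex.I * (j : ℂ) * (x : ℂ)))}

/-- `L₂^{s-}(F)`: the closed subspace of `L₂(F)` generated by `e^{ijλ} δ_ν`, `j ∈ ℤ ∖ S`. -/
def L2obs {T : ℕ} (S : Finset ℤ) (F : ℝ → Matrix (Fin T) (Fin T) ℂ) : Set (ℝ → Fin T → ℂ) :=
  {b | b ∈ L2 F ∧ ∀ ε : ℝ≥0∞, 0 < ε → ∃ p ∈ observedSpan T S, weightedSq F (b - p) < ε}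

/-- The mean square error `Δ(h; f, g)` of the estimate with spectral characteristic `h`, of the
functional `∑_{j ∈ S} a(j)ᵀ ζ(j)`. -/
def mse {T : ℕ} (S : Finset ℤ) (a : ℤ → Fin T → ℂ) (h : ℝ → Fin T → ℂ)
    (f g : MatrixL1 T) : ℝ≥0∞ :=
  ENNReal.ofReal (1 / (2 * Real.pi)) * weightedSq f (transferFn S a - h)
    + ENNReal.ofReal (1 / (2 * Real.pi)) * weightedSq g h

/-- `h` is (a version of) the spectral characteristic `h(f, g)` of the optimal linear estimate:
it minimizes `Δ(·; f, g)` over `L₂^{s-}(f + g)`. -/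
def IsOptimal {T : ℕ} (S : Finset ℤ) (a : ℤ → Fin T → ℂ) (f g : MatrixL1 T)
    (h : ℝ → Fin T → ℂ) : Prop :=
  h ∈ L2obs S (⇑f + ⇑g) ∧ ∀ h' ∈ L2obs S (⇑f + ⇑g), mse S a h f g ≤ mse S a h' f g

/-- The optimal mean square error `Δ(f, g) = min {Δ(h; f, g) : h ∈ L₂^{s-}(f + g)}`. -/
def optMse {T : ℕ} (S : Finset ℤ) (a : ℤ → Fin T → ℂ) (f g : MatrixL1 T) : ℝ≥0∞ :=
  ⨅ h ∈ L2obs S (⇑f + ⇑g), mse S a h f g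

/-- The minimality condition `∫ Tr F(λ)⁻¹ dλ < ∞`; it includes that `F` is invertible a.e. -/
def MinimalityCondition {T : ℕ} (F : ℝ → Matrix (Fin T) (Fin T) ℂ) : Prop :=
  (∀ᵐ x ∂freq, IsUnit (F x)) ∧ ∫⁻ x, ENNReal.ofReal ((F x)⁻¹.trace).re ∂freq < ⊤

/-- `(f₀, g₀)` is least favorable in `D` for the optimal linear estimation:
`Δ(f₀, g₀) = max {Δ(f, g) : (f, g) ∈ D}`. -/
def IsLeastFavorable {T : ℕ} (S : Finset ℤ) (a : ℤ → Fin T → ℂ)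
    (D : Set (MatrixL1 T × MatrixL1 T)) (f₀ g₀ : MatrixL1 T) : Prop :=
  (f₀, g₀) ∈ D ∧ ∀ p ∈ D, optMse S a p.1 p.2 ≤ optMse S a f₀ g₀

/-- `H_D = ⋂_{(f, g) ∈ D} L₂^{s-}(f + g)`. -/
def HD {T : ℕ} (S : Finset ℤ) (D : Set (MatrixL1 T × MatrixL1 T)) : Set (ℝ → Fin T → ℂ) :=
  ⋂ p ∈ D, L2obs S (⇑p.1 + ⇑p.2)

/-- `h₀` is minimax (robust): `h₀ ∈ H_D`, the maximum of `Δ(h₀; f, g)` over `D` is attained, and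
it is the minimum over `h ∈ H_D` of the supremum of `Δ(h; f, g)` over `D`. -/
def IsMinimax {T : ℕ} (S : Finset ℤ) (a : ℤ → Fin T → ℂ)
    (D : Set (MatrixL1 T × MatrixL1 T)) (h₀ : ℝ → Fin T → ℂ) : Prop :=
  h₀ ∈ HD S D ∧ ∃ v : ℝ≥0∞,
    IsGreatest ((fun p => mse S a h₀ p.1 p.2) '' D) v ∧
    IsLeast ((fun h => ⨆ p ∈ D, mse S a h p.1 p.2) '' HD S D) v

open Classical in
/-- The indicator function `δ(· | D)` of convex analysis. -/
def indicatorFn {X : Type*} (D : Set X) (p : X) : EReal := if p ∈ D then 0 else ⊤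

/-- The objective `Δ_D(f, g) = -Δ(h₀; f, g) + δ((f, g) | D)` on `L₁ × L₁`. It is written as
`-(Δ - δ)` so that the value outside `D` is `+∞` also where `Δ(h₀; f, g) = +∞`. -/
def objective {T : ℕ} (S : Finset ℤ) (a : ℤ → Fin T → ℂ) (h₀ : ℝ → Fin T → ℂ)
    (D : Set (MatrixL1 T × MatrixL1 T)) (p : MatrixL1 T × MatrixL1 T) : EReal :=
  -((mse S a h₀ p.1 p.2 : EReal) - indicatorFn D p)

theorem objective_of_mem {T : ℕ} (S : Finset ℤ) (a : ℤ → Fin T → ℂ) (h₀ : ℝ → Fin T → ℂ)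
    (D : Set (MatrixL1 T × MatrixL1 T)) (p : MatrixL1 T × MatrixL1 T) (hp : p ∈ D) :
    objective S a h₀ D p = -(mse S a h₀ p.1 p.2 : EReal) := by
  simp [objective, indicatorFn, hp]

theorem objective_of_notMem {T : ℕ} (S : Finset ℤ) (a : ℤ → Fin T → ℂ) (h₀ : ℝ → Fin T → ℂ)
    (D : Set (MatrixL1 T × MatrixL1 T)) (p : MatrixL1 T × MatrixL1 T) (hp : p ∉ D) :
    objective S a h₀ D p = ⊤ := by
  simp [objective, indicatorFn, hp]

/-- `x₀` solves the unconstrained problem `φ(x) → inf`. -/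
def IsSolution {X : Type*} (φ : X → EReal) (x₀ : X) : Prop := ∀ x, φ x₀ ≤ φ x

/-- The subdifferential of `φ` at `x₀`. -/
def subdifferential {X : Type*} [NormedAddCommGroup X] [NormedSpace ℝ X] (φ : X → EReal)
    (x₀ : X) : Set (X →L[ℝ] ℝ) :=
  {u | ∀ x, φ x₀ + ((u (x - x₀) : ℝ) : EReal) ≤ φ x}

end

end MinimaxInterpolation

namespace MinimaxInterpolation

open Filter Topology

/-! Part (i) is Fermat's rule, valid for any function: the subgradient inequality at the zero
functional is minimality. For (ii), a solution satisfies `Δ(h₀; f, g) ≤ Δ(h₀; f₀, g₀) = Δ(f₀, g₀)`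
on `D`, and least favorability follows from `Δ(f, g) ≤ Δ(h₀; f, g)`. This last inequality needs `h₀`
to be admissible for `(f, g)`, that is `h₀ ∈ L₂^{s-}(f + g)`, whereas only `h₀ ∈ L₂^{s-}(f₀ + g₀)`
is given. The minimax claim needs no such transfer, since `h₀ ∈ H_D` is assumed there.

The transfer (`mem_L2obs_of_mem_L2`) rests on a description of `L₂^{s-}(F)` that does not mention
`F`: under the minimality condition, it consists of the elements of `L₂(F)` whose Fourier
coefficients vanish on `S`. Minimality embeds `L₂(F)` continuously in `L₁`, so these coefficients
are continuous and vanish on the closed span. Conversely, if the coefficients of `b` vanish on `S`,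
so do those of its residual `r` after projection on `L₂^{s-}(F)`. Orthogonality makes `F r̄` a
trigonometric polynomial with frequencies in `-S`, hence `∫ rᵀ F r̄ = 0`. The density `f + g` need
not satisfy minimality, but `f₀ + g₀ + f + g` does in the weak form `DominatesNorm`; the description
is applied there, and membership then descends to `f + g`.

Existence and uniqueness of `h₀` come from the parallelogram law: near-minimizers are close in the
form of `f₀ + g₀`, a minimizing sequence has an a.e. limit by the `L₁` bound, and Fatou's lemma
concludes. -/

/-- The sesquilinear form `uᵀ M \overline{v}`. -/
noncomputable def sesq {T : ℕ} (M : Matrix (Fin T) (Fin T) ℂ) (u v : Fin T → ℂ) : ℂ :=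
  u ⬝ᵥ (M *ᵥ star v)

/-! ### Positive semidefinite forms at a single frequency -/

section Pointwise

variable {T : ℕ} {M : Matrix (Fin T) (Fin T) ℂ}

theorem sesq_add_left (u u' v : Fin T → ℂ) : sesq M (u + u') v = sesq M u v + sesq M u' v := by
  simp [sesq, add_dotProduct]

theorem sesq_add_right (u v v' : Fin T → ℂ) : sesq M u (v + v') = sesq M u v + sesq M u v' := by
  simp [sesq, Matrix.mulVec_add, dotProduct_add]

theorem sesq_sub_left (u u' v : Fin T → ℂ) : sesq M (u - u') v = sesq M u v - sesq M u' v := by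
  simp [sesq, sub_dotProduct]

theorem sesq_sub_right (u v v' : Fin T → ℂ) : sesq M u (v - v') = sesq M u v - sesq M u v' := by
  simp [sesq, Matrix.mulVec_sub, dotProduct_sub]

theorem sesq_smul_left (c : ℂ) (u v : Fin T → ℂ) : sesq M (c • u) v = c * sesq M u v := by
  simp [sesq]

theorem sesq_smul_right (c : ℂ) (u v : Fin T → ℂ) : sesq M u (c • v) = star c * sesq M u v := by
  simp [sesq, Matrix.mulVec_smul]

theorem sesq_add_matrix (M M' : Matrix (Fin T) (Fin T) ℂ) (u v : Fin T → ℂ) :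
    sesq (M + M') u v = sesq M u v + sesq M' u v := by
  simp [sesq, Matrix.add_mulVec, dotProduct_add]

theorem sesq_eq_sum (u v : Fin T → ℂ) : sesq M u v = ∑ i, ∑ j, u i * M i j * star (v j) := by
  simp [sesq, dotProduct, Matrix.mulVec, Finset.mul_sum, mul_assoc]

theorem sesq_self_re_nonneg (hM : M.PosSemidef) (u : Fin T → ℂ) : 0 ≤ (sesq M u u).re := by
  have := hM.dotProduct_mulVec_nonneg (star u)
  rw [star_star] at this
  exact (Complex.le_def.1 this).1

theorem sesq_conj (hM : M.PosSemidef) (u v : Fin T → ℂ) : star (sesq M u v) = sesq M v u := by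
  rw [sesq_eq_sum, sesq_eq_sum, Finset.sum_comm, star_sum]
  refine Finset.sum_congr rfl fun i _ => ?_
  rw [star_sum]
  refine Finset.sum_congr rfl fun j _ => ?_
  rw [← hM.isHermitian.apply i j]
  simp
  ring

-- Cauchy–Schwarz: factoring `M = Bᴴ B` turns the form into a Euclidean inner product.
open scoped MatrixOrder Matrix.Norms.L2Operator in
theorem norm_sesq_sq_le (hM : M.PosSemidef) (u v : Fin T → ℂ) :
    ‖sesq M u v‖ ^ 2 ≤ (sesq M u u).re * (sesq M v v).re := by
  obtain ⟨B, rfl⟩ := CStarAlgebra.nonneg_iff_eq_star_mul_self.mp hM.nonneg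
  rw [Matrix.star_eq_conjTranspose]
  have key : ∀ u v : Fin T → ℂ, sesq (Bᴴ * B) u v
      = inner ℂ (WithLp.toLp 2 (B *ᵥ star u)) (WithLp.toLp 2 (B *ᵥ star v)) := by
    intro u v
    rw [EuclideanSpace.inner_toLp_toLp, sesq, ← Matrix.mulVec_mulVec, Matrix.dotProduct_mulVec,
      Matrix.star_mulVec, star_star, dotProduct_comm]
  have hself : ∀ u : Fin T → ℂ, (sesq (Bᴴ * B) u u).re = ‖WithLp.toLp 2 (B *ᵥ star u)‖ ^ 2 := by
    intro u
    rw [key]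
    exact inner_self_eq_norm_sq (𝕜 := ℂ) _
  rw [hself, hself, key, ← mul_pow]
  gcongr
  exact norm_inner_le_norm _ _

theorem sesq_self_re_add (u v : Fin T → ℂ) :
    (sesq M (u + v) (u + v)).re + (sesq M (u - v) (u - v)).re
      = 2 * (sesq M u u).re + 2 * (sesq M v v).re := by
  simp only [sesq_add_left, sesq_add_right, sesq_sub_left, sesq_sub_right, Complex.add_re,
    Complex.sub_re]
  ring

theorem sesq_self_re_add_smul (hM : M.PosSemidef) (u v : Fin T → ℂ) (t : ℝ) :
    (sesq M (u + (t : ℂ) • v) (u + (t : ℂ) • v)).re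
      = (sesq M u u).re + 2 * t * (sesq M v u).re + t ^ 2 * (sesq M v v).re := by
  have h : (sesq M u v).re = (sesq M v u).re := by
    rw [← sesq_conj hM]; simp
  simp only [sesq_add_left, sesq_add_right, sesq_smul_left, sesq_smul_right, Complex.add_re]
  simp [h]
  ring

/-- The coordinate `b i` is the form of `b` against `c`, where `star c = M⁻¹ eᵢ`. Cauchy–Schwarz
bounds its square by the form of `b` times `(M⁻¹)ᵢᵢ`, which is at most the trace. -/
theorem norm_sq_le_trace_inv_mul (hM : M.PosSemidef) (hu : IsUnit M) (b : Fin T → ℂ) :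
    ‖b‖ ^ 2 ≤ (M⁻¹.trace).re * (sesq M b b).re := by
  have hdet : IsUnit M.det := (Matrix.isUnit_iff_isUnit_det M).1 hu
  have hinv : M⁻¹.PosSemidef := hM.inv
  have hdiag : ∀ i, 0 ≤ (M⁻¹ i i).re := fun i => (Complex.le_def.1 (hinv.diag_nonneg (i := i))).1
  have htr : (M⁻¹.trace).re = ∑ i, (M⁻¹ i i).re := by simp [Matrix.trace]
  have hb := sesq_self_re_nonneg hM b
  have hcoord : ∀ i, ‖b i‖ ^ 2 ≤ (M⁻¹.trace).re * (sesq M b b).re := by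
    intro i
    set c : Fin T → ℂ := star (M⁻¹ *ᵥ Pi.single i 1) with hc
    have h := norm_sesq_sq_le hM b c
    have hMc : M *ᵥ star c = Pi.single i 1 := by
      rw [hc, star_star, Matrix.mulVec_mulVec, Matrix.mul_nonsing_inv _ hdet, Matrix.one_mulVec]
    have h1 : sesq M b c = b i := by simp [sesq, hMc]
    have h2 : (sesq M c c).re = (M⁻¹ i i).re := by
      rw [sesq, hMc, hc]
      simp
    rw [h1, h2, mul_comm] at h
    refine h.trans (mul_le_mul_of_nonneg_right ?_ hb)
    rw [htr]
    exact Finset.single_le_sum (f := fun i => (M⁻¹ i i).re) (fun j _ => hdiag j)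
      (Finset.mem_univ i)
  have hnn : 0 ≤ (M⁻¹.trace).re * (sesq M b b).re :=
    mul_nonneg (htr ▸ Finset.sum_nonneg fun j _ => hdiag j) hb
  have : ‖b‖ ≤ √((M⁻¹.trace).re * (sesq M b b).re) :=
    (pi_norm_le_iff_of_nonneg (Real.sqrt_nonneg _)).2 fun i => Real.le_sqrt_of_sq_le (hcoord i)
  calc ‖b‖ ^ 2 ≤ √((M⁻¹.trace).re * (sesq M b b).re) ^ 2 := by gcongr
    _ = _ := Real.sq_sqrt hnn

end Pointwise

theorem continuous_sesq (T : ℕ) :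
    Continuous fun p : Matrix (Fin T) (Fin T) ℂ × (Fin T → ℂ) × (Fin T → ℂ) =>
      sesq p.1 p.2.1 p.2.2 := by
  simp only [sesq_eq_sum]
  fun_prop

theorem norm_sesq_le {T : ℕ} (M : Matrix (Fin T) (Fin T) ℂ) (u v : Fin T → ℂ) :
    ‖sesq M u v‖ ≤ T * (T * (‖u‖ * ‖M‖ * ‖v‖)) := by
  rw [sesq_eq_sum]
  have h : ∀ i j, ‖u i * M i j * star (v j)‖ ≤ ‖u‖ * ‖M‖ * ‖v‖ := by
    intro i j
    rw [norm_mul, norm_mul, norm_star]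
    gcongr
    · exact norm_le_pi_norm u i
    · exact Matrix.norm_entry_le_entrywise_sup_norm M
    · exact norm_le_pi_norm v j
  calc _ ≤ ∑ _i : Fin T, ∑ _j : Fin T, ‖u‖ * ‖M‖ * ‖v‖ :=
        (norm_sum_le _ _).trans <| Finset.sum_le_sum fun i _ =>
          (norm_sum_le _ _).trans <| Finset.sum_le_sum fun j _ => h i j
    _ = _ := by simp

/-! ### The weighted square integral as a squared seminorm with values in `[0, ∞]` -/

section WeightedSq

variable {T : ℕ} {F G : ℝ → Matrix (Fin T) (Fin T) ℂ} {b c : ℝ → Fin T → ℂ}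

theorem weightedSq_eq (F : ℝ → Matrix (Fin T) (Fin T) ℂ) (b : ℝ → Fin T → ℂ) :
    weightedSq F b = ∫⁻ x, ENNReal.ofReal (sesq (F x) (b x) (b x)).re ∂freq := rfl

theorem aestronglyMeasurable_sesq (hF : AEStronglyMeasurable F freq) (hb : AEMeasurable b freq)
    (hc : AEMeasurable c freq) :
    AEStronglyMeasurable (fun x => sesq (F x) (b x) (c x)) freq :=
  (continuous_sesq T).comp_aestronglyMeasurable
    (hF.prodMk (hb.aestronglyMeasurable.prodMk hc.aestronglyMeasurable))

theorem aemeasurable_ofReal_sesq (hF : AEStronglyMeasurable F freq) (hb : AEMeasurable b freq) :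
    AEMeasurable (fun x => ENNReal.ofReal (sesq (F x) (b x) (b x)).re) freq :=
  (Complex.measurable_re.comp_aemeasurable
    (aestronglyMeasurable_sesq hF hb hb).aemeasurable).ennreal_ofReal

theorem weightedSq_smul (z : ℂ) (b : ℝ → Fin T → ℂ) :
    weightedSq F (z • b) = ENNReal.ofReal (‖z‖ ^ 2) * weightedSq F b := by
  rw [weightedSq_eq, weightedSq_eq, ← lintegral_const_mul' _ _ ENNReal.ofReal_ne_top]
  refine lintegral_congr fun x => ?_
  rw [← ENNReal.ofReal_mul (by positivity), Pi.smul_apply, sesq_smul_left, sesq_smul_right,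
    ← mul_assoc]
  congr 1
  have : z * star z = ((‖z‖ ^ 2 : ℝ) : ℂ) := by
    simpa using Complex.mul_conj' z
  rw [this, Complex.re_ofReal_mul]

theorem weightedSq_neg (b : ℝ → Fin T → ℂ) : weightedSq F (-b) = weightedSq F b := by
  have := weightedSq_smul (F := F) (-1) b
  simpa using this

theorem weightedSq_sub_comm (b c : ℝ → Fin T → ℂ) :
    weightedSq F (b - c) = weightedSq F (c - b) := by
  rw [← weightedSq_neg, neg_sub]

theorem weightedSq_two_smul (b : ℝ → Fin T → ℂ) :
    weightedSq F ((2 : ℂ) • b) = 4 * weightedSq F b := by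
  rw [weightedSq_smul]
  norm_num

/-- No finiteness is needed, but semidefiniteness is: `ENNReal.ofReal` truncates negative values and
would break additivity. -/
theorem weightedSq_parallelogram (hF : AEStronglyMeasurable F freq)
    (hP : ∀ᵐ x ∂freq, (F x).PosSemidef) (hb : AEMeasurable b freq) (hc : AEMeasurable c freq) :
    weightedSq F (b + c) + weightedSq F (b - c) = 2 * weightedSq F b + 2 * weightedSq F c := by
  simp only [weightedSq_eq]
  rw [← lintegral_add_left' (aemeasurable_ofReal_sesq hF (hb.add hc)),
    ← lintegral_const_mul' _ _ (by simp), ← lintegral_const_mul' _ _ (by simp),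
    ← lintegral_add_left' ((aemeasurable_ofReal_sesq hF hb).const_mul _)]
  refine lintegral_congr_ae ?_
  filter_upwards [hP] with x hx
  have h2 : (2 : ℝ≥0∞) = ENNReal.ofReal 2 := by simp
  have hb0 := sesq_self_re_nonneg hx (b x)
  have hc0 := sesq_self_re_nonneg hx (c x)
  rw [h2, ← ENNReal.ofReal_mul (by norm_num), ← ENNReal.ofReal_mul (by norm_num),
    ← ENNReal.ofReal_add (sesq_self_re_nonneg hx _) (sesq_self_re_nonneg hx _),
    ← ENNReal.ofReal_add (by positivity) (by positivity)]
  exact congrArg _ (sesq_self_re_add (b x) (c x))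

theorem weightedSq_add_le (hF : AEStronglyMeasurable F freq)
    (hP : ∀ᵐ x ∂freq, (F x).PosSemidef) (hb : AEMeasurable b freq) (hc : AEMeasurable c freq) :
    weightedSq F (b + c) ≤ 2 * weightedSq F b + 2 * weightedSq F c :=
  (weightedSq_parallelogram hF hP hb hc) ▸ le_self_add

theorem weightedSq_add_matrix (hF : AEStronglyMeasurable F freq)
    (hP : ∀ᵐ x ∂freq, (F x).PosSemidef) (hQ : ∀ᵐ x ∂freq, (G x).PosSemidef)
    (hb : AEMeasurable b freq) :
    weightedSq (F + G) b = weightedSq F b + weightedSq G b := by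
  simp only [weightedSq_eq]
  rw [← lintegral_add_left' (aemeasurable_ofReal_sesq hF hb)]
  refine lintegral_congr_ae ?_
  filter_upwards [hP, hQ] with x hx hy
  rw [← ENNReal.ofReal_add (sesq_self_re_nonneg hx _) (sesq_self_re_nonneg hy _), Pi.add_apply,
    sesq_add_matrix, Complex.add_re]

theorem integrable_sesq_of_bounded (hF : AEStronglyMeasurable F freq)
    (hn : Integrable (fun x => ‖F x‖) freq) (hb : AEMeasurable b freq)
    {C : ℝ} (hC : ∀ x, ‖b x‖ ≤ C) : Integrable (fun x => sesq (F x) (b x) (b x)) freq := by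
  have hC0 : 0 ≤ C := (norm_nonneg _).trans (hC 0)
  refine (((hn.const_mul C).mul_const C).const_mul (T * T : ℝ)).mono'
    (aestronglyMeasurable_sesq hF hb hb) (ae_of_all _ fun x => ?_)
  refine (norm_sesq_le _ _ _).trans ?_
  rw [← mul_assoc]
  gcongr <;> exact hC x

theorem weightedSq_lt_top_of_bounded (hF : AEStronglyMeasurable F freq)
    (hn : Integrable (fun x => ‖F x‖) freq) (hb : AEMeasurable b freq)
    {C : ℝ} (hC : ∀ x, ‖b x‖ ≤ C) : weightedSq F b < ⊤ :=
  (integrable_sesq_of_bounded hF hn hb hC).re.lintegral_lt_top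

/-- Fatou's lemma, the integrand being continuous in the vector argument. -/
theorem weightedSq_le_of_tendsto (hF : AEStronglyMeasurable F freq) {u : ℕ → ℝ → Fin T → ℂ}
    (hu : ∀ n, AEMeasurable (u n) freq)
    (hlim : ∀ᵐ x ∂freq, Tendsto (fun n => u n x) atTop (𝓝 (b x))) :
    weightedSq F b ≤ liminf (fun n => weightedSq F (u n)) atTop := by
  calc weightedSq F b
      = ∫⁻ x, liminf (fun n => ENNReal.ofReal (sesq (F x) (u n x) (u n x)).re) atTop ∂freq := by
        refine lintegral_congr_ae ?_
        filter_upwards [hlim] with x hx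
        refine (Tendsto.liminf_eq ?_).symm
        refine ENNReal.tendsto_ofReal ((Complex.continuous_re.tendsto _).comp ?_)
        exact Tendsto.comp (g := fun p : Matrix (Fin T) (Fin T) ℂ × (Fin T → ℂ) × (Fin T → ℂ) =>
            sesq p.1 p.2.1 p.2.2) (f := fun n => (F x, u n x, u n x))
          ((continuous_sesq T).tendsto (F x, b x, b x))
          (tendsto_const_nhds.prodMk_nhds (hx.prodMk_nhds hx))
    _ ≤ liminf (fun n => ∫⁻ x, ENNReal.ofReal (sesq (F x) (u n x) (u n x)).re ∂freq) atTop :=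
        lintegral_liminf_le' fun n => aemeasurable_ofReal_sesq hF (hu n)

end WeightedSq

/-! ### Consequences of minimality: control in `L₁` -/

/-- The form of `F` dominates the norm, up to an integrable weight: `‖b‖² ≤ w · bᵀ F \overline{b}`.
This is what the minimality condition provides. -/
def DominatesNorm {T : ℕ} (F : ℝ → Matrix (Fin T) (Fin T) ℂ) : Prop :=
  ∃ w : ℝ → ℝ, ∫⁻ x, ENNReal.ofReal (w x) ∂freq < ⊤ ∧
    ∀ᵐ x ∂freq, 0 ≤ w x ∧ ∀ b : Fin T → ℂ, ‖b‖ ^ 2 ≤ w x * (sesq (F x) b b).re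

section DominatesNorm

variable {T : ℕ} {F G : ℝ → Matrix (Fin T) (Fin T) ℂ} {b : ℝ → Fin T → ℂ}

theorem MinimalityCondition.dominatesNorm (h : MinimalityCondition F)
    (hP : ∀ᵐ x ∂freq, (F x).PosSemidef) : DominatesNorm F := by
  refine ⟨fun x => ((F x)⁻¹.trace).re, h.2, ?_⟩
  filter_upwards [h.1, hP] with x hu hx
  refine ⟨?_, norm_sq_le_trace_inv_mul hx hu⟩
  exact (Complex.le_def.1 hx.inv.trace_nonneg).1

/-- The same weight `w` serves, since adding `G` only enlarges the form. This allows adding a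
density for which no minimality is known. -/
theorem DominatesNorm.add (h : DominatesNorm F) (hQ : ∀ᵐ x ∂freq, (G x).PosSemidef) :
    DominatesNorm (F + G) := by
  obtain ⟨w, hw, h⟩ := h
  refine ⟨w, hw, ?_⟩
  filter_upwards [h, hQ] with x hx hy
  refine ⟨hx.1, fun b => (hx.2 b).trans (mul_le_mul_of_nonneg_left ?_ hx.1)⟩
  rw [Pi.add_apply, sesq_add_matrix, Complex.add_re]
  linarith [sesq_self_re_nonneg hy b]

/-- Pointwise `‖b‖² ≤ w q = (ε w)(ε⁻¹ q) ≤ (ε w + ε⁻¹ q)²`, with `q` the form of `b`. The free `ε`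
plays the role of Cauchy–Schwarz for integrals, and `W = ∫ w` does not depend on `b`. -/
theorem DominatesNorm.exists_lintegral_enorm_le (h : DominatesNorm F)
    (hP : ∀ᵐ x ∂freq, (F x).PosSemidef) (hF : AEStronglyMeasurable F freq) :
    ∃ W : ℝ≥0∞, W < ⊤ ∧ ∀ (b : ℝ → Fin T → ℂ), AEMeasurable b freq → ∀ ε : ℝ, 0 < ε →
      ∫⁻ x, ‖b x‖ₑ ∂freq ≤ ENNReal.ofReal ε * W + ENNReal.ofReal ε⁻¹ * weightedSq F b := by
  obtain ⟨w, hw, h⟩ := h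
  refine ⟨_, hw, fun b hb ε hε => ?_⟩
  rw [weightedSq_eq, ← lintegral_const_mul' _ _ ENNReal.ofReal_ne_top,
    ← lintegral_const_mul' _ _ ENNReal.ofReal_ne_top,
    ← lintegral_add_right' _ ((aemeasurable_ofReal_sesq hF hb).const_mul _)]
  refine lintegral_mono_ae ?_
  filter_upwards [h, hP] with x hx hy
  have hq := sesq_self_re_nonneg hy (b x)
  have hw0 := hx.1
  rw [← ENNReal.ofReal_mul hε.le, ← ENNReal.ofReal_mul (by positivity),
    ← ENNReal.ofReal_add (by positivity) (by positivity), ← ofReal_norm]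
  refine ENNReal.ofReal_le_ofReal (abs_le_of_sq_le_sq' ?_ (by positivity)).2
  have : (ε * w x) * (ε⁻¹ * (sesq (F x) (b x) (b x)).re) = w x * (sesq (F x) (b x) (b x)).re := by
    field_simp
  have h1 := hx.2 (b x)
  have h2 : 0 ≤ ε * w x := by positivity
  have h3 : 0 ≤ ε⁻¹ * (sesq (F x) (b x) (b x)).re := by positivity
  nlinarith [mul_nonneg h2 h3]

theorem DominatesNorm.integrable (h : DominatesNorm F) (hP : ∀ᵐ x ∂freq, (F x).PosSemidef)
    (hF : AEStronglyMeasurable F freq) (hb : b ∈ L2 F) : Integrable b freq := by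
  obtain ⟨W, hW, h⟩ := h.exists_lintegral_enorm_le hP hF
  refine ⟨hb.1.aestronglyMeasurable, (h b hb.1 1 one_pos).trans_lt ?_⟩
  simpa using ⟨hW, hb.2⟩

theorem DominatesNorm.ae_eq_zero (h : DominatesNorm F) (hP : ∀ᵐ x ∂freq, (F x).PosSemidef)
    (hF : AEStronglyMeasurable F freq) (hb : AEMeasurable b freq) (h0 : weightedSq F b = 0) :
    b =ᵐ[freq] 0 := by
  obtain ⟨w, -, h⟩ := h
  rw [weightedSq_eq, lintegral_eq_zero_iff' (aemeasurable_ofReal_sesq hF hb)] at h0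
  filter_upwards [h, hP, h0] with x hx hy hz
  have hz' : (sesq (F x) (b x) (b x)).re = 0 :=
    le_antisymm (ENNReal.ofReal_eq_zero.1 hz) (sesq_self_re_nonneg hy _)
  have := hx.2 (b x)
  rw [hz', mul_zero] at this
  simpa using this

theorem DominatesNorm.exists_limit (h : DominatesNorm F) (hP : ∀ᵐ x ∂freq, (F x).PosSemidef)
    (hF : AEStronglyMeasurable F freq) {u : ℕ → ℝ → Fin T → ℂ}
    (hu : ∀ n, AEMeasurable (u n) freq)
    (hc : ∀ n m k, n ≤ m → n ≤ k → weightedSq F (u m - u k) ≤ ENNReal.ofReal ((1 / 4) ^ n)) :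
    ∃ l : ℝ → Fin T → ℂ, Measurable l ∧
      ∀ᵐ x ∂freq, Tendsto (fun n => u n x) atTop (𝓝 (l x)) := by
  obtain ⟨W, hW, h⟩ := h.exists_lintegral_enorm_le hP hF
  have hlim : ∀ᵐ x ∂freq, ∃ l, Tendsto (fun n => u n x) atTop (𝓝 l) := by
    -- Taking `ε = 2⁻ⁿ` against `4⁻ⁿ` gives an `L₁` distance of at most `2⁻ⁿ (W + 1)`; the bound `W
    -- + 2` makes the inequality strict.
    refine Lp.ae_tendsto_of_cauchy_eLpNorm (p := 1) (B := fun n => (2⁻¹ : ℝ≥0∞) ^ n * (W + 2))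
      (fun n => (hu n).aestronglyMeasurable) le_rfl ?_ ?_
    · rw [ENNReal.tsum_mul_right, ENNReal.tsum_geometric]
      refine ENNReal.mul_ne_top ?_ (by simpa using hW.ne)
      simp
    · intro n m k hm hk
      rw [eLpNorm_one_eq_lintegral_enorm]
      refine (h _ ((hu m).sub (hu k)) ((1 / 2) ^ n) (by positivity)).trans_lt ?_
      have h2 : ENNReal.ofReal ((1 / 2) ^ n) = (2⁻¹ : ℝ≥0∞) ^ n := by
        rw [ENNReal.ofReal_pow (by norm_num)]
        congr 1
        rw [one_div, ENNReal.ofReal_inv_of_pos (by norm_num)]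
        simp
      calc _ ≤ ENNReal.ofReal ((1 / 2) ^ n) * W
            + ENNReal.ofReal ((1 / 2) ^ n)⁻¹ * ENNReal.ofReal ((1 / 4) ^ n) := by
            gcongr
            exact hc n m k hm hk
        _ = (2⁻¹ : ℝ≥0∞) ^ n * (W + 1) := by
            rw [← ENNReal.ofReal_mul (by positivity), ← inv_pow, ← mul_pow, mul_add, ← h2]
            norm_num
        _ < _ := by
            refine ENNReal.mul_lt_mul_right (by simp) (by simp) ?_
            exact ENNReal.add_lt_add_left hW.ne (by norm_num)
  obtain ⟨l, hl, h⟩ := exists_stronglyMeasurable_limit_of_tendsto_ae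
    (fun n => (hu n).aestronglyMeasurable) hlim
  exact ⟨l, hl.measurable, h⟩

end DominatesNorm

/-! ### Spectral densities and the spaces `L₂(F)`, `L₂^{s-}(F)` -/

/-- A representative of a spectral density. -/
structure IsDensityFn {T : ℕ} (F : ℝ → Matrix (Fin T) (Fin T) ℂ) : Prop where
  meas : AEStronglyMeasurable F freq
  norm_integrable : Integrable (fun x => ‖F x‖) freq
  posSemidef : ∀ᵐ x ∂freq, (F x).PosSemidef

theorem IsSpectralDensity.isDensityFn {T : ℕ} {f : MatrixL1 T} (h : IsSpectralDensity f) :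
    IsDensityFn ⇑f :=
  ⟨(L1.integrable_coeFn f).1, (L1.integrable_coeFn f).norm, h⟩

/-- The exponential `e^{ijλ} δ_ν`. -/
noncomputable def expSingle {T : ℕ} (j : ℤ) (ν : Fin T) (x : ℝ) : Fin T → ℂ :=
  Pi.single ν (Complex.exp (Complex.I * (j : ℂ) * (x : ℂ)))

theorem norm_cexp_I_mul (j : ℤ) (x : ℝ) :
    ‖Complex.exp (Complex.I * (j : ℂ) * (x : ℂ))‖ = 1 := by
  simp [Complex.norm_exp]

theorem continuous_expSingle {T : ℕ} (j : ℤ) (ν : Fin T) : Continuous (expSingle j ν) := by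
  unfold expSingle
  exact (continuous_single ν).comp (by fun_prop)

theorem norm_expSingle {T : ℕ} (j : ℤ) (ν : Fin T) (x : ℝ) : ‖expSingle j ν x‖ = 1 := by
  rw [expSingle, Pi.norm_single, norm_cexp_I_mul]

theorem expSingle_mem_observedSpan {T : ℕ} {S : Finset ℤ} {j : ℤ} (hj : j ∉ S) (ν : Fin T) :
    expSingle j ν ∈ observedSpan T S :=
  Submodule.subset_span ⟨j, hj, ν, rfl⟩

section L2obs

variable {T : ℕ} {F G : ℝ → Matrix (Fin T) (Fin T) ℂ} {b c : ℝ → Fin T → ℂ} {S : Finset ℤ}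

theorem IsDensityFn.zero : IsDensityFn (0 : ℝ → Matrix (Fin T) (Fin T) ℂ) :=
  ⟨aestronglyMeasurable_zero, by simp, ae_of_all _ fun _ => Matrix.PosSemidef.zero⟩

theorem IsDensityFn.add (hF : IsDensityFn F) (hG : IsDensityFn G) : IsDensityFn (F + G) :=
  ⟨hF.1.add hG.1, (hF.2.add hG.2).mono' (hF.1.add hG.1).norm
    (ae_of_all _ fun x => (norm_norm _).trans_le (norm_add_le _ _)), by
    filter_upwards [hF.3, hG.3] with x hx hy using hx.add hy⟩

theorem IsDensityFn.mem_L2_of_bounded (hF : IsDensityFn F) (hb : AEMeasurable b freq)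
    {C : ℝ} (hC : ∀ x, ‖b x‖ ≤ C) : b ∈ L2 F :=
  ⟨hb, weightedSq_lt_top_of_bounded hF.meas hF.norm_integrable hb hC⟩

theorem IsDensityFn.weightedSq_add_le (hF : IsDensityFn F) (hb : AEMeasurable b freq)
    (hc : AEMeasurable c freq) : weightedSq F (b + c) ≤ 2 * weightedSq F b + 2 * weightedSq F c :=
  MinimaxInterpolation.weightedSq_add_le hF.meas hF.posSemidef hb hc

theorem IsDensityFn.weightedSq_add_matrix (hF : IsDensityFn F) (hG : IsDensityFn G)
    (hb : AEMeasurable b freq) : weightedSq (F + G) b = weightedSq F b + weightedSq G b :=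
  MinimaxInterpolation.weightedSq_add_matrix hF.meas hF.posSemidef hG.posSemidef hb

/-- Matches the factors 2 in `weightedSq_add_le`, which replaces the triangle inequality in the
approximation arguments. -/
theorem two_mul_add_two_mul_lt {x y δ : ℝ≥0∞} (hx : x < δ / 4) (hy : y < δ / 4) :
    2 * x + 2 * y < δ := by
  have h : 2 * (δ / 4) + 2 * (δ / 4) = δ := by
    rw [← add_mul, show (2 : ℝ≥0∞) + 2 = 4 by norm_num]
    exact ENNReal.mul_div_cancel (by simp) (by simp)
  calc _ < 2 * (δ / 4) + 2 * (δ / 4) :=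
        ENNReal.add_lt_add (ENNReal.mul_lt_mul_right (by simp) (by simp) hx)
          (ENNReal.mul_lt_mul_right (by simp) (by simp) hy)
    _ = δ := h

theorem zero_mem_L2 : (0 : ℝ → Fin T → ℂ) ∈ L2 F :=
  ⟨aemeasurable_const, by simp [weightedSq]⟩

theorem IsDensityFn.add_mem_L2 (hF : IsDensityFn F) (hb : b ∈ L2 F) (hc : c ∈ L2 F) :
    b + c ∈ L2 F :=
  ⟨hb.1.add hc.1, (hF.weightedSq_add_le hb.1 hc.1).trans_lt <|
    ENNReal.add_lt_top.2 ⟨ENNReal.mul_lt_top (by simp) hb.2, ENNReal.mul_lt_top (by simp) hc.2⟩⟩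

theorem smul_mem_L2 (z : ℂ) (hb : b ∈ L2 F) : z • b ∈ L2 F :=
  ⟨hb.1.const_smul z, by
    rw [weightedSq_smul]
    exact ENNReal.mul_lt_top ENNReal.ofReal_lt_top hb.2⟩

theorem IsDensityFn.sub_mem_L2 (hF : IsDensityFn F) (hb : b ∈ L2 F) (hc : c ∈ L2 F) :
    b - c ∈ L2 F := by
  have := hF.add_mem_L2 hb (smul_mem_L2 (-1) hc)
  rwa [neg_one_smul, ← sub_eq_add_neg] at this

theorem IsDensityFn.observedSpan_subset_L2 (hF : IsDensityFn F) :
    ∀ p ∈ observedSpan T S, p ∈ L2 F := by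
  intro p hp
  induction hp using Submodule.span_induction with
  | mem p hp =>
    obtain ⟨j, -, ν, rfl⟩ := hp
    exact hF.mem_L2_of_bounded (continuous_expSingle j ν).aemeasurable
      (fun x => (norm_expSingle j ν x).le)
  | zero => exact zero_mem_L2
  | add p q _ _ hp hq => exact hF.add_mem_L2 hp hq
  | smul z p _ hp => exact smul_mem_L2 z hp

theorem IsDensityFn.observedSpan_subset_L2obs (hF : IsDensityFn F) :
    ∀ p ∈ observedSpan T S, p ∈ L2obs S F := fun p hp =>
  ⟨hF.observedSpan_subset_L2 p hp, fun ε hε => ⟨p, hp, by simpa [weightedSq] using hε⟩⟩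

theorem IsDensityFn.mem_L2obs_of_forall_approx (hF : IsDensityFn F) (hb : AEMeasurable b freq)
    (h : ∀ ε : ℝ≥0∞, 0 < ε → ∃ c ∈ L2obs S F, weightedSq F (b - c) < ε) : b ∈ L2obs S F := by
  refine ⟨?_, fun ε hε => ?_⟩
  · obtain ⟨c, hc, hbc⟩ := h ⊤ (by simp)
    rw [← sub_add_cancel b c]
    exact hF.add_mem_L2 ⟨hb.sub hc.1.1, hbc⟩ hc.1
  · have hε4 : 0 < ε / 4 := ENNReal.div_pos hε.ne' (by simp)
    obtain ⟨c, hc, hbc⟩ := h (ε / 4) hε4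
    obtain ⟨p, hp, hcp⟩ := hc.2 (ε / 4) hε4
    refine ⟨p, hp, ?_⟩
    rw [← sub_add_sub_cancel b c p]
    exact (hF.weightedSq_add_le (hb.sub hc.1.1)
      (hc.1.1.sub (hF.observedSpan_subset_L2 p hp).1)).trans_lt (two_mul_add_two_mul_lt hbc hcp)

theorem IsDensityFn.add_mem_L2obs (hF : IsDensityFn F) (hb : b ∈ L2obs S F)
    (hc : c ∈ L2obs S F) : b + c ∈ L2obs S F := by
  refine ⟨hF.add_mem_L2 hb.1 hc.1, fun ε hε => ?_⟩
  have hε4 : 0 < ε / 4 := ENNReal.div_pos hε.ne' (by simp)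
  obtain ⟨p, hp, hbp⟩ := hb.2 (ε / 4) hε4
  obtain ⟨q, hq, hcq⟩ := hc.2 (ε / 4) hε4
  refine ⟨p + q, add_mem hp hq, ?_⟩
  rw [add_sub_add_comm]
  exact (hF.weightedSq_add_le (hb.1.1.sub (hF.observedSpan_subset_L2 p hp).1)
    (hc.1.1.sub (hF.observedSpan_subset_L2 q hq).1)).trans_lt (two_mul_add_two_mul_lt hbp hcq)

theorem smul_mem_L2obs (z : ℂ) (hb : b ∈ L2obs S F) :
    z • b ∈ L2obs S F := by
  refine ⟨smul_mem_L2 z hb.1, fun ε hε => ?_⟩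
  obtain ⟨δ, hδ, hlt⟩ : ∃ δ : ℝ≥0∞, 0 < δ ∧ δ * ENNReal.ofReal (‖z‖ ^ 2) < ε :=
    (ENNReal.exists_pos_mul_lt ENNReal.ofReal_ne_top hε.ne')
  obtain ⟨p, hp, hbp⟩ := hb.2 δ hδ
  refine ⟨z • p, Submodule.smul_mem _ _ hp, ?_⟩
  rw [← smul_sub, weightedSq_smul, mul_comm]
  exact (by gcongr : _ ≤ _).trans_lt hlt

theorem L2obs_subset_add_right (hF : IsDensityFn F) (hG : IsDensityFn G) :
    L2obs S (F + G) ⊆ L2obs S F := by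
  intro b hb
  have hle : ∀ {c : ℝ → Fin T → ℂ}, AEMeasurable c freq →
      weightedSq F c ≤ weightedSq (F + G) c := fun hc => by
    rw [hF.weightedSq_add_matrix hG hc]
    exact le_self_add
  refine ⟨⟨hb.1.1, (hle hb.1.1).trans_lt hb.1.2⟩, fun ε hε => ?_⟩
  obtain ⟨p, hp, h⟩ := hb.2 ε hε
  exact ⟨p, hp, (hle (hb.1.1.sub (hF.observedSpan_subset_L2 p hp).1)).trans_lt h⟩

end L2obs

/-! ### Existence and uniqueness of the minimizer -/

theorem add_liminf_le_liminf_add (u v : ℕ → ℝ≥0∞) :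
    liminf u atTop + liminf v atTop ≤ liminf (fun n => u n + v n) atTop := by
  have hmono : ∀ w : ℕ → ℝ≥0∞, Monotone fun n => ⨅ i ≥ n, w i := fun w n m hnm =>
    biInf_mono fun i hi => le_trans hnm hi
  simp only [liminf_eq_iSup_iInf_of_nat]
  rw [ENNReal.iSup_add_iSup_of_monotone (hmono u) (hmono v)]
  exact iSup_mono fun n => le_iInf₂ fun i hi => add_le_add (iInf₂_le i hi) (iInf₂_le i hi)

section Minimizer

variable {T : ℕ} {f g : ℝ → Matrix (Fin T) (Fin T) ℂ} {B : ℝ → Fin T → ℂ} {S : Finset ℤ}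

/-- The error functional `∫ (B - h)ᵀ f \overline{(B - h)} + ∫ hᵀ g \overline{h}`. -/
noncomputable def errSq (f g : ℝ → Matrix (Fin T) (Fin T) ℂ) (B h : ℝ → Fin T → ℂ) : ℝ≥0∞ :=
  weightedSq f (B - h) + weightedSq g h

/-- The parallelogram law for `f` at `B - h`, `B - h'` and for `g` at `h`, `h'`: up to sign both
differences are `h - h'`, so they merge into the weight `f + g`. -/
theorem errSq_midpoint (hf : IsDensityFn f) (hg : IsDensityFn g) (hB : AEMeasurable B freq)
    {h h' : ℝ → Fin T → ℂ} (hh : AEMeasurable h freq) (hh' : AEMeasurable h' freq) :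
    4 * errSq f g B ((1 / 2 : ℂ) • (h + h')) + weightedSq (f + g) (h - h')
      = 2 * errSq f g B h + 2 * errSq f g B h' := by
  have h1 := weightedSq_parallelogram hf.meas hf.posSemidef (hB.sub hh) (hB.sub hh')
  have h2 := weightedSq_parallelogram hg.meas hg.posSemidef hh hh'
  have e1 : B - h + (B - h') = (2 : ℂ) • (B - (1 / 2 : ℂ) • (h + h')) := by
    rw [smul_sub, smul_smul]
    norm_num
    rw [two_smul]
    abel
  have e2 : h + h' = (2 : ℂ) • ((1 / 2 : ℂ) • (h + h')) := by
    rw [smul_smul]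
    norm_num
  have e3 : B - h - (B - h') = h' - h := by abel
  rw [e1, e3, weightedSq_two_smul, weightedSq_sub_comm h' h] at h1
  rw [e2, weightedSq_two_smul] at h2
  rw [hf.weightedSq_add_matrix hg (hh.sub hh')]
  unfold errSq
  calc _ = (4 * weightedSq f (B - (1 / 2 : ℂ) • (h + h')) + weightedSq f (h - h'))
        + (4 * weightedSq g ((1 / 2 : ℂ) • (h + h')) + weightedSq g (h - h')) := by ring
    _ = _ := by rw [h1, h2]; ring

/-- `h` minimizes the error functional over `L₂^{s-}(f + g)`. -/
def IsMinimizer (S : Finset ℤ) (f g : ℝ → Matrix (Fin T) (Fin T) ℂ) (B h : ℝ → Fin T → ℂ) : Prop :=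
  h ∈ L2obs S (f + g) ∧ ∀ h' ∈ L2obs S (f + g), errSq f g B h ≤ errSq f g B h'

/-- The midpoint is also a competitor, so its error is at least `m`. For `ε > 0` this makes
minimizing sequences Cauchy; for `ε = 0` it gives uniqueness. -/
theorem weightedSq_sub_le_of_errSq_le (hf : IsDensityFn f) (hg : IsDensityFn g)
    (hB : AEMeasurable B freq) {m ε : ℝ≥0∞} (hm : m ≠ ⊤)
    (hmin : ∀ h ∈ L2obs S (f + g), m ≤ errSq f g B h)
    {h h' : ℝ → Fin T → ℂ} (hh : h ∈ L2obs S (f + g)) (hh' : h' ∈ L2obs S (f + g))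
    (hle : errSq f g B h ≤ m + ε) (hle' : errSq f g B h' ≤ m + ε) :
    weightedSq (f + g) (h - h') ≤ 4 * ε := by
  have hfg := hf.add hg
  have hmid := hmin _ (smul_mem_L2obs (1 / 2) (hfg.add_mem_L2obs hh hh'))
  have h4 : 4 * m ≠ ⊤ := ENNReal.mul_ne_top (by simp) hm
  refine (ENNReal.add_le_add_iff_left h4).1 ?_
  calc 4 * m + weightedSq (f + g) (h - h')
      ≤ 4 * errSq f g B ((1 / 2 : ℂ) • (h + h')) + weightedSq (f + g) (h - h') := by gcongr
    _ = 2 * errSq f g B h + 2 * errSq f g B h' := errSq_midpoint hf hg hB hh.1.1 hh'.1.1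
    _ ≤ 2 * (m + ε) + 2 * (m + ε) := by gcongr
    _ = 4 * m + 4 * ε := by ring

theorem exists_isMinimizer (hf : IsDensityFn f) (hg : IsDensityFn g) (hd : DominatesNorm (f + g))
    (hB : B ∈ L2 f) (S : Finset ℤ) : ∃ h, IsMinimizer S f g B h := by
  have hfg := hf.add hg
  set m : ℝ≥0∞ := ⨅ h ∈ L2obs S (f + g), errSq f g B h with hm_def
  have hmin : ∀ h ∈ L2obs S (f + g), m ≤ errSq f g B h := fun h hh => iInf₂_le h hh
  have h0 : errSq f g B 0 < ⊤ := by
    have : weightedSq g 0 = 0 := by simp [weightedSq]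
    simpa [errSq, this] using hB.2
  have hm : m ≠ ⊤ := ((hmin 0 (hfg.observedSpan_subset_L2obs 0 (zero_mem _))).trans_lt h0).ne
  -- The exponent `n + 1` absorbs the factor 4 in the distance estimate.
  have hseq : ∀ n : ℕ, ∃ h ∈ L2obs S (f + g),
      errSq f g B h ≤ m + ENNReal.ofReal ((1 / 4) ^ (n + 1)) := by
    intro n
    have : m < m + ENNReal.ofReal ((1 / 4) ^ (n + 1)) :=
      ENNReal.lt_add_right hm (by simp)
    simp only [hm_def, iInf_lt_iff] at this
    obtain ⟨h, hh, hlt⟩ := this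
    exact ⟨h, hh, hlt.le⟩
  choose u hu hle using hseq
  have hcau : ∀ n k l, n ≤ k → n ≤ l →
      weightedSq (f + g) (u k - u l) ≤ ENNReal.ofReal ((1 / 4) ^ n) := by
    intro n k l hk hl
    have hmono : ∀ k, n ≤ k → errSq f g B (u k) ≤ m + ENNReal.ofReal ((1 / 4) ^ (n + 1)) := by
      intro k hk
      refine (hle k).trans ?_
      gcongr m + ENNReal.ofReal ?_
      exact pow_le_pow_of_le_one (by norm_num) (by norm_num) (Nat.succ_le_succ hk)
    refine (weightedSq_sub_le_of_errSq_le hf hg hB.1 hm hmin (hu k) (hu l)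
      (hmono k hk) (hmono l hl)).trans_eq ?_
    rw [show (4 : ℝ≥0∞) = ENNReal.ofReal 4 by simp, ← ENNReal.ofReal_mul (by norm_num), pow_succ]
    congr 1
    ring
  obtain ⟨h, hh, hlim⟩ := hd.exists_limit hfg.posSemidef hfg.meas (fun n => (hu n).1.1) hcau
  have hobs : h ∈ L2obs S (f + g) := by
    refine hfg.mem_L2obs_of_forall_approx hh.aemeasurable fun ε hε => ?_
    have ht : Tendsto (fun n : ℕ => ENNReal.ofReal ((1 / 4) ^ n)) atTop (𝓝 0) := by
      simpa using ENNReal.tendsto_ofReal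
        (tendsto_pow_atTop_nhds_zero_of_lt_one (r := (1 / 4 : ℝ)) (by norm_num) (by norm_num))
    obtain ⟨n, hn⟩ := (ht.eventually_lt_const hε).exists
    refine ⟨u n, hu n, lt_of_le_of_lt ?_ hn⟩
    -- Fatou in `k` with `n` fixed bounds the distance from the limit to `u n`.
    refine (weightedSq_le_of_tendsto (u := fun k => u k - u n) hfg.meas
      (fun k => (hu k).1.1.sub (hu n).1.1) ?_).trans ?_
    · filter_upwards [hlim] with x hx using hx.sub_const _
    · refine liminf_le_of_frequently_le' (Eventually.frequently ?_)
      filter_upwards [eventually_ge_atTop n] with k hk using hcau n k n hk le_rfl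
  refine ⟨h, hobs, fun h' hh' => ?_⟩
  refine le_trans ?_ (hmin h' hh')
  have h1 := weightedSq_le_of_tendsto (b := B - h) (u := fun k => B - u k) hf.meas
      (fun k => hB.1.sub (hu k).1.1) (by filter_upwards [hlim] with x hx using hx.const_sub _)
  have h2 := weightedSq_le_of_tendsto (b := h) (u := u) hg.meas
      (fun k => (hu k).1.1) hlim
  calc errSq f g B h ≤ liminf (fun k => weightedSq f (B - u k)) atTop
        + liminf (fun k => weightedSq g (u k)) atTop := add_le_add h1 h2
    _ ≤ liminf (fun k => errSq f g B (u k)) atTop := add_liminf_le_liminf_add _ _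
    _ ≤ liminf (fun k : ℕ => m + ENNReal.ofReal ((1 / 4) ^ (k + 1))) atTop :=
        liminf_le_liminf (Eventually.of_forall hle)
    _ = m := by
        refine Tendsto.liminf_eq ?_
        have ht : Tendsto (fun n : ℕ => ENNReal.ofReal ((1 / 4) ^ (n + 1))) atTop (𝓝 0) := by
          simpa using ENNReal.tendsto_ofReal ((tendsto_add_atTop_iff_nat 1).2
            (tendsto_pow_atTop_nhds_zero_of_lt_one (r := (1 / 4 : ℝ)) (by norm_num) (by norm_num)))
        simpa using tendsto_const_nhds.add ht

theorem IsMinimizer.ae_eq (hf : IsDensityFn f) (hg : IsDensityFn g) (hd : DominatesNorm (f + g))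
    (hB : B ∈ L2 f) {h h' : ℝ → Fin T → ℂ} (hh : IsMinimizer S f g B h)
    (hh' : IsMinimizer S f g B h') : h =ᵐ[freq] h' := by
  have hfg := hf.add hg
  have h0 : errSq f g B 0 < ⊤ := by
    have : weightedSq g 0 = 0 := by simp [weightedSq]
    simpa [errSq, this] using hB.2
  have hm : errSq f g B h ≠ ⊤ :=
    ((hh.2 0 (hfg.observedSpan_subset_L2obs 0 (zero_mem _))).trans_lt h0).ne
  have := weightedSq_sub_le_of_errSq_le hf hg hB.1 hm hh.2 hh.1 hh'.1 (ε := 0) (by simp)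
    (by simpa using hh'.2 h hh.1)
  rw [mul_zero, nonpos_iff_eq_zero] at this
  filter_upwards [hd.ae_eq_zero hfg.posSemidef hfg.meas (hh.1.1.1.sub hh'.1.1.1) this] with x hx
  exact sub_eq_zero.1 hx

end Minimizer

/-! ### Fourier coefficients of integrable functions on `(-π, π]` -/

/-- The character `e^{ijλ}`. -/
noncomputable def expChar (j : ℤ) (x : ℝ) : ℂ := Complex.exp (Complex.I * (j : ℂ) * (x : ℂ))

theorem continuous_expChar (j : ℤ) : Continuous (expChar j) := by
  unfold expChar
  fun_prop

theorem norm_expChar (j : ℤ) (x : ℝ) : ‖expChar j x‖ = 1 := norm_cexp_I_mul j x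

theorem expChar_mul_expChar (j k : ℤ) (x : ℝ) : expChar j x * expChar k x = expChar (j + k) x := by
  simp only [expChar, ← Complex.exp_add]
  congr 1
  push_cast
  ring

theorem integrable_expChar_mul {φ : ℝ → ℂ} (hφ : Integrable φ freq) (j : ℤ) :
    Integrable (fun x => expChar j x * φ x) freq :=
  hφ.bdd_mul (continuous_expChar j).aestronglyMeasurable
    (ae_of_all _ fun x => (norm_expChar j x).le)

theorem integral_freq_expChar (j : ℤ) :
    ∫ x, expChar j x ∂freq = if j = 0 then ((2 * Real.pi : ℝ) : ℂ) else 0 := by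
  rw [← intervalIntegral.integral_of_le (by linarith [Real.pi_pos])]
  split_ifs with h
  · subst h
    simp [expChar]
    ring
  · have hc : Complex.I * (j : ℂ) ≠ 0 := mul_ne_zero Complex.I_ne_zero (by exact_mod_cast h)
    unfold expChar
    rw [integral_exp_mul_complex hc, div_eq_zero_iff, sub_eq_zero]
    left
    rw [Complex.exp_eq_exp_iff_exists_int]
    refine ⟨j, ?_⟩
    push_cast
    ring

/-- Integration against `ψ` is a continuous functional on `C(circle)` that kills the characters,
hence everything by density. Smooth test functions supported in the open interval extend to the
circle, and they determine `ψ` a.e. -/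
theorem ae_eq_zero_of_forall_integral_expChar {ψ : ℝ → ℂ} (hψ : Integrable ψ freq)
    (h : ∀ j : ℤ, ∫ x, expChar j x * ψ x ∂freq = 0) : ψ =ᵐ[freq] 0 := by
  have hpi := Real.pi_pos
  have : Fact (0 < 2 * Real.pi) := ⟨by positivity⟩
  have hint : ∀ φ : C(AddCircle (2 * Real.pi), ℂ),
      Integrable (fun x : ℝ => φ (x : AddCircle (2 * Real.pi)) * ψ x) freq := fun φ =>
    hψ.bdd_mul (c := ‖φ‖) (φ.continuous.comp (AddCircle.continuous_mk' _)).aestronglyMeasurable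
      (ae_of_all _ fun x => φ.norm_coe_le_norm _)
  let ℓ : C(AddCircle (2 * Real.pi), ℂ) →L[ℂ] ℂ := LinearMap.mkContinuous
    { toFun := fun φ => ∫ x : ℝ, φ (x : AddCircle (2 * Real.pi)) * ψ x ∂freq
      map_add' := fun φ φ' => by
        simp only [ContinuousMap.add_apply, add_mul]
        exact integral_add (hint φ) (hint φ')
      map_smul' := fun c φ => by
        simp only [ContinuousMap.smul_apply, smul_eq_mul, mul_assoc, RingHom.id_apply]
        exact integral_const_mul c _ } (∫ x, ‖ψ x‖ ∂freq) (fun φ => by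
      refine (norm_integral_le_integral_norm _).trans ?_
      simp only [norm_mul]
      rw [← integral_mul_const]
      refine integral_mono_of_nonneg (ae_of_all _ fun x => by positivity)
        (hψ.norm.mul_const _) (ae_of_all _ fun x => ?_)
      exact (mul_le_mul_of_nonneg_right (φ.norm_coe_le_norm _) (norm_nonneg _)).trans_eq
        (mul_comm _ _))
  have hℓ : ℓ = 0 := by
    refine ContinuousLinearMap.ext_on
      (Submodule.dense_iff_topologicalClosure_eq_top.2 span_fourier_closure_eq_top) ?_
    rintro _ ⟨j, rfl⟩
    refine Eq.trans ?_ (h j)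
    refine integral_congr_ae (ae_of_all _ fun x => ?_)
    simp only [fourier_coe_apply, expChar]
    congr 2
    push_cast
    field_simp
  have hU : ∀ᵐ x ∂volume, x ∈ Ioo (-Real.pi) Real.pi → ψ x = 0 := by
    refine isOpen_Ioo.ae_eq_zero_of_integral_contDiff_smul_eq_zero
      (IntegrableOn.mono_set hψ Ioo_subset_Ioc_self).locallyIntegrableOn ?_
    intro g hg _ hsupp
    have hout : ∀ x, x ∉ Ioo (-Real.pi) Real.pi → g x = 0 := fun x hx =>
      image_eq_zero_of_notMem_tsupport fun hx' => hx (hsupp hx')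
    have hper : (fun x => (g x : ℂ)) (-Real.pi) = (fun x => (g x : ℂ)) (-Real.pi + 2 * Real.pi) := by
      simp only
      rw [hout (-Real.pi) (by simp), hout (-Real.pi + 2 * Real.pi) fun h => by linarith [h.2]]
    let φ : C(AddCircle (2 * Real.pi), ℂ) :=
      ⟨AddCircle.liftIco (2 * Real.pi) (-Real.pi) (fun x => (g x : ℂ)),
        AddCircle.liftIco_continuous hper
          (Complex.continuous_ofReal.comp hg.continuous).continuousOn⟩
    have hφ : ∫ x : ℝ, φ (x : AddCircle (2 * Real.pi)) * ψ x ∂freq = 0 :=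
      DFunLike.congr_fun hℓ φ
    rw [← hφ, ← setIntegral_eq_integral_of_forall_compl_eq_zero (s := Ioc (-Real.pi) Real.pi)]
    · refine setIntegral_congr_fun measurableSet_Ioc fun x hx => ?_
      have : φ (x : AddCircle (2 * Real.pi)) = (g x : ℂ) := by
        change AddCircle.liftIco (2 * Real.pi) (-Real.pi) (fun x => (g x : ℂ)) x = _
        -- Continuity of the lift is known for `Ico`, while `freq` lives on `Ioc`; the two lifts
        -- agree because `g` vanishes at both endpoints.
        rw [← AddCircle.liftIoc_eq_liftIco hper, AddCircle.liftIoc_coe_apply]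
        convert hx using 1
        congr 1
        ring
      simp only [this]
      exact Complex.real_smul
    · intro x hx
      rw [hout x fun hx' => hx (Ioo_subset_Ioc_self hx'), zero_smul]
  rw [EventuallyEq, freq, ← Measure.restrict_congr_set Ioo_ae_eq_Ioc]
  exact (ae_restrict_iff' measurableSet_Ioo).2 hU

/-- The difference with the partial Fourier sum over `-S` has all coefficients zero. -/
theorem ae_eq_sum_expChar {S : Finset ℤ} {φ : ℝ → ℂ} (hφ : Integrable φ freq)
    (h : ∀ j ∉ S, ∫ x, expChar j x * φ x ∂freq = 0) :
    ∃ c : ℤ → ℂ, φ =ᵐ[freq] fun x => ∑ l ∈ S, c l * expChar (-l) x := by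
  have hpi : ((2 * Real.pi : ℝ) : ℂ) ≠ 0 := by
    exact_mod_cast (by positivity : (2 * Real.pi) ≠ 0)
  refine ⟨fun l => ((2 * Real.pi : ℝ) : ℂ)⁻¹ * ∫ x, expChar l x * φ x ∂freq, ?_⟩
  set c : ℤ → ℂ := fun l => ((2 * Real.pi : ℝ) : ℂ)⁻¹ * ∫ x, expChar l x * φ x ∂freq with hc
  have hci : ∀ j : ℤ, Integrable (expChar j) freq := fun j =>
    ⟨(continuous_expChar j).aestronglyMeasurable, HasFiniteIntegral.of_bounded (C := 1)
      (ae_of_all _ fun x => (norm_expChar j x).le)⟩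
  have hP : Integrable (fun x => ∑ l ∈ S, c l * expChar (-l) x) freq :=
    integrable_finsetSum _ fun l _ => (hci _).const_mul _
  have hPj : ∀ j : ℤ, ∫ x, expChar j x * ∑ l ∈ S, c l * expChar (-l) x ∂freq
      = ∑ l ∈ S, c l * if j = l then ((2 * Real.pi : ℝ) : ℂ) else 0 := by
    intro j
    have : ∀ x, expChar j x * ∑ l ∈ S, c l * expChar (-l) x
        = ∑ l ∈ S, c l * expChar (j + -l) x := by
      intro x
      rw [Finset.mul_sum]
      refine Finset.sum_congr rfl fun l _ => ?_
      rw [← expChar_mul_expChar]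
      ring
    simp only [this]
    rw [integral_finsetSum _ fun l _ => (hci _).const_mul _]
    refine Finset.sum_congr rfl fun l _ => ?_
    rw [integral_const_mul, integral_freq_expChar]
    simp only [← sub_eq_add_neg, sub_eq_zero]
  have key := ae_eq_zero_of_forall_integral_expChar (hφ.sub hP) fun j => by
    simp only [Pi.sub_apply, mul_sub]
    rw [integral_sub (integrable_expChar_mul hφ j) (integrable_expChar_mul hP j), hPj]
    by_cases hj : j ∈ S
    · simp only [mul_ite, mul_zero, Finset.sum_ite_eq, hj, if_true, hc]
      field_simp
      simp
    · rw [h j hj]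
      simp [hj]
  filter_upwards [key] with x hx
  exact sub_eq_zero.1 hx

/-! ### Fourier description of `L₂^{s-}(F)` -/

section Orthogonality

variable {T : ℕ} {F G : ℝ → Matrix (Fin T) (Fin T) ℂ} {b c : ℝ → Fin T → ℂ} {S : Finset ℤ}

theorem IsDensityFn.integrable_sesq_self (hF : IsDensityFn F) (hb : b ∈ L2 F) :
    Integrable (fun x => (sesq (F x) (b x) (b x)).re) freq := by
  have hm := (Complex.measurable_re.comp_aemeasurable
    (aestronglyMeasurable_sesq hF.meas hb.1 hb.1).aemeasurable).aestronglyMeasurable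
  refine ⟨hm, ?_⟩
  rw [hasFiniteIntegral_iff_ofReal]
  · exact hb.2
  · filter_upwards [hF.posSemidef] with x hx using sesq_self_re_nonneg hx _

theorem IsDensityFn.weightedSq_eq_ofReal_integral (hF : IsDensityFn F) (hb : b ∈ L2 F) :
    weightedSq F b = ENNReal.ofReal (∫ x, (sesq (F x) (b x) (b x)).re ∂freq) := by
  rw [weightedSq_eq, ofReal_integral_eq_lintegral_ofReal (hF.integrable_sesq_self hb)]
  filter_upwards [hF.posSemidef] with x hx using sesq_self_re_nonneg hx _

theorem IsDensityFn.integral_sesq_self_nonneg (hF : IsDensityFn F) :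
    0 ≤ ∫ x, (sesq (F x) (b x) (b x)).re ∂freq :=
  integral_nonneg_of_ae (by
    filter_upwards [hF.posSemidef] with x hx using sesq_self_re_nonneg hx _)

theorem IsDensityFn.integrable_sesq (hF : IsDensityFn F) (hb : b ∈ L2 F) (hc : c ∈ L2 F) :
    Integrable (fun x => sesq (F x) (b x) (c x)) freq := by
  refine ((hF.integrable_sesq_self hb).add (hF.integrable_sesq_self hc)).mono'
    (aestronglyMeasurable_sesq hF.meas hb.1 hc.1) ?_
  filter_upwards [hF.posSemidef] with x hx
  have h1 := sesq_self_re_nonneg hx (b x)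
  have h2 := sesq_self_re_nonneg hx (c x)
  have h3 := norm_sesq_sq_le hx (b x) (c x)
  refine (abs_le_of_sq_le_sq' ?_ (add_nonneg h1 h2)).2
  nlinarith [mul_nonneg h1 h2]

/-- First-order condition: along `b + t p`, `t` real, the increment is a nonnegative quadratic
without constant term, so its discriminant kills the linear term. Replacing `p` by `i p` handles the
imaginary part. -/
theorem IsDensityFn.integral_sesq_eq_zero_of_forall_le (hF : IsDensityFn F) (hb : b ∈ L2 F)
    {V : Submodule ℂ (ℝ → Fin T → ℂ)} (hV : ∀ p ∈ V, p ∈ L2 F)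
    (hle : ∀ p ∈ V, weightedSq F b ≤ weightedSq F (b + p)) :
    ∀ p ∈ V, ∫ x, sesq (F x) (p x) (b x) ∂freq = 0 := by
  have hre : ∀ p ∈ V, (∫ x, sesq (F x) (p x) (b x) ∂freq).re = 0 := by
    intro p hp
    have hpL := hV p hp
    have hI := hF.integrable_sesq hpL hb
    have hquad : ∀ t : ℝ, 0 ≤ (∫ x, (sesq (F x) (p x) (p x)).re ∂freq) * (t * t)
        + (2 * (∫ x, sesq (F x) (p x) (b x) ∂freq).re) * t + 0 := by
      intro t
      have htp := V.smul_mem (t : ℂ) hp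
      have h := hle _ htp
      rw [hF.weightedSq_eq_ofReal_integral hb,
        hF.weightedSq_eq_ofReal_integral (hF.add_mem_L2 hb (hV _ htp)),
        ENNReal.ofReal_le_ofReal_iff hF.integral_sesq_self_nonneg] at h
      have hexp : ∫ x, (sesq (F x) ((b + (t : ℂ) • p) x) ((b + (t : ℂ) • p) x)).re ∂freq
          = ∫ x, ((sesq (F x) (b x) (b x)).re + 2 * t * (sesq (F x) (p x) (b x)).re)
              + t ^ 2 * (sesq (F x) (p x) (p x)).re ∂freq := by
        refine integral_congr_ae ?_
        filter_upwards [hF.posSemidef] with x hx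
        exact sesq_self_re_add_smul hx (b x) (p x) t
      have hIre : Integrable (fun x => (sesq (F x) (p x) (b x)).re) freq := hI.re
      have hIeq : ∫ x, (sesq (F x) (p x) (b x)).re ∂freq
          = (∫ x, sesq (F x) (p x) (b x) ∂freq).re := integral_re hI
      have hsum : Integrable (fun x => (sesq (F x) (b x) (b x)).re
          + 2 * t * (sesq (F x) (p x) (b x)).re) freq :=
        (hF.integrable_sesq_self hb).add (hIre.const_mul _)
      rw [hexp, integral_add hsum ((hF.integrable_sesq_self hpL).const_mul _),
        integral_add (hF.integrable_sesq_self hb) (hIre.const_mul _), integral_const_mul,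
        integral_const_mul, hIeq] at h
      linarith
    have := discrim_le_zero hquad
    rw [discrim, mul_zero, sub_zero] at this
    have h0 := pow_eq_zero_iff (two_ne_zero) |>.1 (le_antisymm this (sq_nonneg _))
    linarith
  intro p hp
  refine Complex.ext (hre p hp) ?_
  have h := hre _ (V.smul_mem Complex.I hp)
  simp only [Pi.smul_apply, sesq_smul_left] at h
  rw [integral_const_mul] at h
  simpa using h

theorem sesq_expSingle_left (M : Matrix (Fin T) (Fin T) ℂ) (j : ℤ) (ν : Fin T) (x : ℝ)
    (v : Fin T → ℂ) : sesq M (expSingle j ν x) v = expChar j x * (M *ᵥ star v) ν := by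
  simp [sesq, expSingle, expChar]

theorem IsDensityFn.integrable_mulVec_star (hF : IsDensityFn F) (hb : b ∈ L2 F) (ν : Fin T) :
    Integrable (fun x => (F x *ᵥ star (b x)) ν) freq := by
  have h := hF.integrable_sesq
    (hF.mem_L2_of_bounded (continuous_expSingle 0 ν).aemeasurable
      (fun x => (norm_expSingle 0 ν x).le)) hb
  simpa [sesq_expSingle_left, expChar] using h

theorem integrable_apply {b : ℝ → Fin T → ℂ} (hb : Integrable b freq) (ν : Fin T) :
    Integrable (fun x => b x ν) freq :=
  hb.mono ((measurable_pi_apply ν).comp_aemeasurable hb.1.aemeasurable).aestronglyMeasurable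
    (ae_of_all _ fun x => norm_le_pi_norm (b x) ν)

theorem integrable_and_integral_eq_zero_of_mem_observedSpan {p : ℝ → Fin T → ℂ}
    (hp : p ∈ observedSpan T S) {l : ℤ} (hl : l ∈ S) (ν : Fin T) :
    Integrable (fun x => p x ν) freq ∧ ∫ x, expChar (-l) x * p x ν ∂freq = 0 := by
  induction hp using Submodule.span_induction with
  | mem p hp =>
    obtain ⟨j, hj, μ, rfl⟩ := hp
    change Integrable (fun x => expSingle j μ x ν) freq ∧
      ∫ x, expChar (-l) x * expSingle j μ x ν ∂freq = 0
    have hi : Integrable (expSingle j μ) freq :=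
      ⟨(continuous_expSingle j μ).aestronglyMeasurable, HasFiniteIntegral.of_bounded (C := 1)
        (ae_of_all _ fun x => (norm_expSingle j μ x).le)⟩
    refine ⟨integrable_apply hi ν, ?_⟩
    by_cases hμ : ν = μ
    · subst hμ
      have : ∀ x, expChar (-l) x * expSingle j ν x ν = expChar (-l + j) x := fun x => by
        rw [← expChar_mul_expChar]
        simp [expSingle, expChar]
      simp only [this]
      rw [integral_freq_expChar, if_neg]
      rintro h
      exact hj (by rwa [show j = l by omega])
    · simp [expSingle, Pi.single_eq_of_ne hμ]
  | zero => simp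
  | add p q _ _ hp hq =>
    refine ⟨hp.1.add hq.1, ?_⟩
    simp only [Pi.add_apply, mul_add]
    rw [integral_add (integrable_expChar_mul hp.1 _) (integrable_expChar_mul hq.1 _), hp.2, hq.2,
      add_zero]
  | smul z p _ hp =>
    refine ⟨hp.1.const_mul z, ?_⟩
    simp only [Pi.smul_apply, smul_eq_mul, mul_left_comm _ z]
    rw [integral_const_mul, hp.2, mul_zero]

/-- The Fourier coefficients of the elements of `L₂^{s-}(F)` vanish on `S`. -/
theorem integral_expChar_mul_eq_zero (hF : IsDensityFn F) (hd : DominatesNorm F)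
    (hb : b ∈ L2obs S F) {l : ℤ} (hl : l ∈ S) (ν : Fin T) :
    ∫ x, expChar (-l) x * b x ν ∂freq = 0 := by
  obtain ⟨W, hW, h⟩ := hd.exists_lintegral_enorm_le hF.posSemidef hF.meas
  have hbi := hd.integrable hF.posSemidef hF.meas hb.1
  have hbound : ∀ ε : ℝ, 0 < ε →
      ‖∫ x, expChar (-l) x * b x ν ∂freq‖ₑ ≤ ENNReal.ofReal ε * (W + 1) := by
    intro ε hε
    -- Accuracy `ε²` compensates the factor `ε⁻¹` in the `L₁` bound.
    obtain ⟨p, hp, hlt⟩ := hb.2 (ENNReal.ofReal (ε ^ 2)) (by simp; positivity)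
    have hpm := (hF.observedSpan_subset_L2 p hp).1
    obtain ⟨hpi, hp0⟩ := integrable_and_integral_eq_zero_of_mem_observedSpan hp hl ν
    have hsub : ∫ x, expChar (-l) x * b x ν ∂freq
        = ∫ x, expChar (-l) x * (b x ν - p x ν) ∂freq := by
      simp only [mul_sub]
      rw [integral_sub (integrable_expChar_mul (integrable_apply hbi ν) _)
        (integrable_expChar_mul hpi _), hp0, sub_zero]
    calc ‖∫ x, expChar (-l) x * b x ν ∂freq‖ₑ
        ≤ ∫⁻ x, ‖expChar (-l) x * (b x ν - p x ν)‖ₑ ∂freq := by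
          rw [hsub]
          exact enorm_integral_le_lintegral_enorm _
      _ ≤ ∫⁻ x, ‖(b - p) x‖ₑ ∂freq := by
          refine lintegral_mono fun x => ?_
          rw [enorm_le_iff_norm_le, norm_mul, norm_expChar, one_mul]
          exact norm_le_pi_norm ((b - p) x) ν
      _ ≤ ENNReal.ofReal ε * W + ENNReal.ofReal ε⁻¹ * weightedSq F (b - p) :=
          h _ (hb.1.1.sub hpm) ε hε
      _ ≤ ENNReal.ofReal ε * W + ENNReal.ofReal ε⁻¹ * ENNReal.ofReal (ε ^ 2) := by gcongr
      _ = ENNReal.ofReal ε * (W + 1) := by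
          rw [← ENNReal.ofReal_mul (by positivity), mul_add, mul_one]
          congr 2
          field_simp
  have ht : Tendsto (fun ε : ℝ => ENNReal.ofReal ε * (W + 1)) (𝓝[>] 0) (𝓝 0) := by
    have := ENNReal.Tendsto.mul_const (b := W + 1)
      (ENNReal.tendsto_ofReal (tendsto_id (x := 𝓝 (0 : ℝ)))) (Or.inr (by simpa using hW.ne))
    simp only [ENNReal.ofReal_zero, zero_mul, id] at this
    exact this.mono_left nhdsWithin_le_nhds
  have := ge_of_tendsto ht (by filter_upwards [self_mem_nhdsWithin] with ε hε using hbound ε hε)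
  simpa using this

/-- An element of `L₂(F)` whose Fourier coefficients vanish on `S` belongs to `L₂^{s-}(F)`. -/
theorem mem_L2obs_of_integral_expChar_eq_zero (hF : IsDensityFn F) (hd : DominatesNorm F)
    (hb : b ∈ L2 F) (h0 : ∀ l ∈ S, ∀ ν, ∫ x, expChar (-l) x * b x ν ∂freq = 0) :
    b ∈ L2obs S F := by
  have hd' : DominatesNorm (F + 0) := by rwa [add_zero]
  -- With zero noise density the minimizer is the orthogonal projection of `b`.
  obtain ⟨k, hk, hmin⟩ := exists_isMinimizer hF IsDensityFn.zero hd' hb S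
  rw [add_zero] at hk hmin
  have herr : ∀ h : ℝ → Fin T → ℂ, errSq F 0 b h = weightedSq F (b - h) := fun h => by
    simp [errSq, weightedSq]
  set r := b - k with hr
  have hrL : r ∈ L2 F := hF.sub_mem_L2 hb hk.1
  have horth : ∀ p ∈ observedSpan T S, ∫ x, sesq (F x) (p x) (r x) ∂freq = 0 := by
    refine hF.integral_sesq_eq_zero_of_forall_le hrL hF.observedSpan_subset_L2 fun p hp => ?_
    have h := hmin (k + (-1 : ℂ) • p)
      (hF.add_mem_L2obs hk (smul_mem_L2obs _ (hF.observedSpan_subset_L2obs p hp)))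
    rw [herr, herr] at h
    convert h using 2
    rw [hr, neg_one_smul]
    abel
  have hri := hd.integrable hF.posSemidef hF.meas hrL
  have hki := hd.integrable hF.posSemidef hF.meas hk.1
  have hbi := hd.integrable hF.posSemidef hF.meas hb
  have hr0 : ∀ l ∈ S, ∀ ν, ∫ x, expChar (-l) x * r x ν ∂freq = 0 := by
    intro l hl ν
    simp only [hr, Pi.sub_apply, mul_sub]
    rw [integral_sub (integrable_expChar_mul (integrable_apply hbi ν) _)
      (integrable_expChar_mul (integrable_apply hki ν) _), h0 l hl ν,
      integral_expChar_mul_eq_zero hF hd hk hl ν, sub_zero]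
  -- Orthogonality to `e^{ijλ} δ_ν` for `j ∉ S` leaves only the frequencies `-l`, `l ∈ S`, in `F
  -- r̄`; these are exactly the ones against which `r` integrates to zero.
  have htrig : ∀ ν, ∃ c : ℤ → ℂ, (fun x => (F x *ᵥ star (r x)) ν) =ᵐ[freq]
      fun x => ∑ l ∈ S, c l * expChar (-l) x := fun ν => by
    refine ae_eq_sum_expChar (hF.integrable_mulVec_star hrL ν) fun j hj => ?_
    rw [← horth _ (expSingle_mem_observedSpan hj ν)]
    simp only [sesq_expSingle_left]
  choose c hc using htrig
  have hzero : ∫ x, sesq (F x) (r x) (r x) ∂freq = 0 := by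
    have : ∫ x, sesq (F x) (r x) (r x) ∂freq
        = ∫ x, ∑ ν, ∑ l ∈ S, c ν l * (expChar (-l) x * r x ν) ∂freq := by
      refine integral_congr_ae ?_
      filter_upwards [ae_all_iff.2 hc] with x hx
      simp only [sesq, dotProduct, hx, Finset.mul_sum]
      exact Finset.sum_congr rfl fun ν _ => Finset.sum_congr rfl fun l _ => by ring
    have hi : ∀ ν l, Integrable (fun x => c ν l * (expChar (-l) x * r x ν)) freq := fun ν l =>
      (integrable_expChar_mul (integrable_apply hri ν) _).const_mul _
    rw [this, integral_finsetSum _ fun ν _ => integrable_finsetSum _ fun l _ => hi ν l]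
    refine Finset.sum_eq_zero fun ν _ => ?_
    rw [integral_finsetSum _ fun l _ => hi ν l]
    refine Finset.sum_eq_zero fun l hl => ?_
    rw [integral_const_mul, hr0 l hl ν, mul_zero]
  have hQ : weightedSq F r = 0 := by
    have hre : ∫ x, (sesq (F x) (r x) (r x)).re ∂freq
        = (∫ x, sesq (F x) (r x) (r x) ∂freq).re := integral_re (hF.integrable_sesq hrL hrL)
    rw [hF.weightedSq_eq_ofReal_integral hrL, hre, hzero]
    simp
  exact hF.mem_L2obs_of_forall_approx hb.1 fun ε hε => ⟨k, hk, by rwa [← hr, hQ]⟩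

/-- Under the minimality condition for `G`, the elements of `L₂^{s-}(G)` which lie in `L₂(F)` lie
in `L₂^{s-}(F)`. -/
theorem mem_L2obs_of_mem_L2 (hF : IsDensityFn F) (hG : IsDensityFn G) (hd : DominatesNorm G)
    (hbG : b ∈ L2obs S G) (hbF : b ∈ L2 F) : b ∈ L2obs S F := by
  have hbGF : b ∈ L2 (G + F) := ⟨hbF.1, by
    rw [hG.weightedSq_add_matrix hF hbF.1]
    exact ENNReal.add_lt_top.2 ⟨hbG.1.2, hbF.2⟩⟩
  -- The criterion is applied to `G + F`, which inherits domination from `G`; `F` alone may lack it.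
  have := mem_L2obs_of_integral_expChar_eq_zero (S := S) (hG.add hF) (hd.add hF.posSemidef) hbGF
    fun l hl ν => integral_expChar_mul_eq_zero hG hd hbG hl ν
  rw [add_comm] at this
  exact L2obs_subset_add_right hF hG this

end Orthogonality

/-! ### The optimal spectral characteristic -/

section Optimal

variable {T : ℕ} {S : Finset ℤ} {a : ℤ → Fin T → ℂ} {f g : MatrixL1 T} {h : ℝ → Fin T → ℂ}

theorem measurable_transferFn (S : Finset ℤ) (a : ℤ → Fin T → ℂ) :
    Measurable (transferFn S a) := by
  refine Continuous.measurable ?_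
  unfold transferFn
  fun_prop

theorem norm_transferFn_le (S : Finset ℤ) (a : ℤ → Fin T → ℂ) (x : ℝ) :
    ‖transferFn S a x‖ ≤ ∑ j ∈ S, ‖a j‖ := by
  refine (norm_sum_le _ _).trans (Finset.sum_le_sum fun j _ => ?_)
  rw [norm_smul, norm_cexp_I_mul, one_mul]

theorem transferFn_mem_L2 {F : ℝ → Matrix (Fin T) (Fin T) ℂ} (hF : IsDensityFn F)
    (S : Finset ℤ) (a : ℤ → Fin T → ℂ) : transferFn S a ∈ L2 F :=
  hF.mem_L2_of_bounded (measurable_transferFn S a).aemeasurable (norm_transferFn_le S a)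

theorem mse_eq (S : Finset ℤ) (a : ℤ → Fin T → ℂ) (h : ℝ → Fin T → ℂ) (f g : MatrixL1 T) :
    mse S a h f g = ENNReal.ofReal (1 / (2 * Real.pi)) * errSq f g (transferFn S a) h :=
  (mul_add _ _ _).symm

theorem ofReal_one_div_two_pi_ne_zero : ENNReal.ofReal (1 / (2 * Real.pi)) ≠ 0 := by
  rw [Ne, ENNReal.ofReal_eq_zero, not_le]
  positivity

theorem isOptimal_iff_isMinimizer :
    IsOptimal S a f g h ↔ IsMinimizer S ⇑f ⇑g (transferFn S a) h := by
  simp only [IsOptimal, IsMinimizer, mse_eq,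
    ENNReal.mul_le_mul_iff_right ofReal_one_div_two_pi_ne_zero ENNReal.ofReal_ne_top]

theorem mse_lt_top_iff : mse S a h f g < ⊤ ↔ errSq f g (transferFn S a) h < ⊤ := by
  rw [mse_eq, ENNReal.mul_lt_top_iff]
  simp only [ENNReal.ofReal_lt_top, true_and, ofReal_one_div_two_pi_ne_zero, false_or,
    or_iff_left_iff_imp]
  rintro h
  simp [h]

theorem exists_unique_isOptimal (hf : IsSpectralDensity f) (hg : IsSpectralDensity g)
    (hmin : MinimalityCondition (⇑f + ⇑g)) :
    ∃ h₀, IsOptimal S a f g h₀ ∧ ∀ h, IsOptimal S a f g h → h =ᵐ[freq] h₀ := by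
  have hf' := hf.isDensityFn
  have hg' := hg.isDensityFn
  have hd := hmin.dominatesNorm (hf'.add hg').posSemidef
  simp only [isOptimal_iff_isMinimizer]
  obtain ⟨h₀, hh₀⟩ := exists_isMinimizer hf' hg' hd (transferFn_mem_L2 hf' S a) S
  exact ⟨h₀, hh₀, fun h hh => hh.ae_eq hf' hg' hd (transferFn_mem_L2 hf' S a) hh₀⟩

/-- `A` is bounded, hence in `L₂(f)`, and `h = A - (A - h)`. -/
theorem mem_L2_add_of_mse_lt_top (hf : IsSpectralDensity f) (hg : IsSpectralDensity g)
    (hh : AEMeasurable h freq) (hlt : mse S a h f g < ⊤) : h ∈ L2 (⇑f + ⇑g) := by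
  have hf' := hf.isDensityFn
  have hA := transferFn_mem_L2 hf' S a
  rw [mse_lt_top_iff, errSq, ENNReal.add_lt_top] at hlt
  refine ⟨hh, ?_⟩
  rw [hf'.weightedSq_add_matrix hg.isDensityFn hh]
  have h1 := (hf'.sub_mem_L2 hA ⟨hA.1.sub hh, hlt.1⟩).2
  rw [sub_sub_cancel] at h1
  exact ENNReal.add_lt_top.2 ⟨h1, hlt.2⟩

end Optimal

/-! ### Least favorable densities and the minimax property -/

section Minimax

variable {T : ℕ} {S : Finset ℤ} {a : ℤ → Fin T → ℂ} {h₀ : ℝ → Fin T → ℂ}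
  {D : Set (MatrixL1 T × MatrixL1 T)} {f₀ g₀ : MatrixL1 T}

theorem isSolution_iff_zero_mem_subdifferential {X : Type*} [NormedAddCommGroup X]
    [NormedSpace ℝ X] {φ : X → EReal} {x₀ : X} :
    IsSolution φ x₀ ↔ 0 ∈ subdifferential φ x₀ := by
  simp [subdifferential, IsSolution]

theorem mse_le_of_isSolution (hmem : (f₀, g₀) ∈ D)
    (h : IsSolution (objective S a h₀ D) (f₀, g₀)) {p : MatrixL1 T × MatrixL1 T} (hp : p ∈ D) :
    mse S a h₀ p.1 p.2 ≤ mse S a h₀ f₀ g₀ := by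
  have := h p
  rw [objective_of_mem _ _ _ _ _ hmem, objective_of_mem _ _ _ _ _ hp, EReal.neg_le_neg_iff] at this
  exact EReal.coe_ennreal_le_coe_ennreal_iff.1 this

theorem IsOptimal.optMse_eq (h : IsOptimal S a f₀ g₀ h₀) :
    optMse S a f₀ g₀ = mse S a h₀ f₀ g₀ :=
  le_antisymm (iInf₂_le h₀ h.1) (le_iInf₂ h.2)

theorem IsOptimal.mse_lt_top (hf : IsSpectralDensity f₀) (hg : IsSpectralDensity g₀)
    (h : IsOptimal S a f₀ g₀ h₀) : mse S a h₀ f₀ g₀ < ⊤ := by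
  have h0 := (hf.isDensityFn.add hg.isDensityFn).observedSpan_subset_L2obs (S := S) 0
    (zero_mem _)
  refine (h.2 0 h0).trans_lt (mse_lt_top_iff.2 ?_)
  have : weightedSq g₀ 0 = 0 := by simp [weightedSq]
  simpa [errSq, this] using (transferFn_mem_L2 hf.isDensityFn S a).2

theorem isLeastFavorable_of_isSolution
    (hD : ∀ p ∈ D, IsSpectralDensity p.1 ∧ IsSpectralDensity p.2) (hmem : (f₀, g₀) ∈ D)
    (hmin : MinimalityCondition (⇑f₀ + ⇑g₀)) (hopt : IsOptimal S a f₀ g₀ h₀)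
    (h : IsSolution (objective S a h₀ D) (f₀, g₀)) : IsLeastFavorable S a D f₀ g₀ := by
  refine ⟨hmem, fun p hp => ?_⟩
  obtain ⟨hf₀, hg₀⟩ := hD _ hmem
  obtain ⟨hf, hg⟩ := hD p hp
  have hF₀ := hf₀.isDensityFn.add hg₀.isDensityFn
  have hle := mse_le_of_isSolution hmem h hp
  -- The solution property bounds the error at `p` by a finite value, which places `h₀` in `L₂(f +
  -- g)`; the Fourier description does the rest.
  have hobs : h₀ ∈ L2obs S (⇑p.1 + ⇑p.2) :=
    mem_L2obs_of_mem_L2 (hf.isDensityFn.add hg.isDensityFn) hF₀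
      (hmin.dominatesNorm hF₀.posSemidef) hopt.1
      (mem_L2_add_of_mse_lt_top hf hg hopt.1.1.1 (hle.trans_lt (hopt.mse_lt_top hf₀ hg₀)))
  calc optMse S a p.1 p.2 ≤ mse S a h₀ p.1 p.2 := iInf₂_le h₀ hobs
    _ ≤ mse S a h₀ f₀ g₀ := hle
    _ = optMse S a f₀ g₀ := hopt.optMse_eq.symm

/-- Saddle point: `(f₀, g₀)` maximizes the error of `h₀` over `D`, and `h₀` minimizes the error at
`(f₀, g₀)`, which bounds the supremum for any competitor from below. -/
theorem isMinimax_of_isSolution (hmem : (f₀, g₀) ∈ D) (hopt : IsOptimal S a f₀ g₀ h₀)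
    (h : IsSolution (objective S a h₀ D) (f₀, g₀)) (hHD : h₀ ∈ HD S D) : IsMinimax S a D h₀ := by
  have hle := fun p (hp : p ∈ D) => mse_le_of_isSolution hmem h hp
  refine ⟨hHD, mse S a h₀ f₀ g₀, ⟨⟨(f₀, g₀), hmem, rfl⟩, ?_⟩, ⟨h₀, hHD, ?_⟩, ?_⟩
  · rintro _ ⟨p, hp, rfl⟩
    exact hle p hp
  · exact le_antisymm (iSup₂_le hle)
      (le_iSup₂ (f := fun p (_ : p ∈ D) => mse S a h₀ p.1 p.2) (f₀, g₀) hmem)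
  · rintro _ ⟨h', hh', rfl⟩
    exact (hopt.2 h' (mem_iInter₂.1 hh' (f₀, g₀) hmem)).trans
      (le_iSup₂ (f := fun p (_ : p ∈ D) => mse S a h' p.1 p.2) (f₀, g₀) hmem)

end Minimax

end MinimaxInterpolation

theorem mainTheorem8 (T s : ℕ) (N K : ℕ → ℕ) (a : ℤ → Fin T → ℂ)
    (Df Dg : Set (MinimaxInterpolation.MatrixL1 T))
    (hDf : ∀ f ∈ Df, MinimaxInterpolation.IsSpectralDensity f)
    (hDg : ∀ g ∈ Dg, MinimaxInterpolation.IsSpectralDensity g)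
    (f₀ g₀ : MinimaxInterpolation.MatrixL1 T) (hf₀ : f₀ ∈ Df) (hg₀ : g₀ ∈ Dg)
    (hmin : MinimaxInterpolation.MinimalityCondition (⇑f₀ + ⇑g₀)) :
    -- the spectral characteristic `h(f₀, g₀)` exists and is unique up to null sets
    (∃ h₀, MinimaxInterpolation.IsOptimal (MinimaxInterpolation.missing s N K) a f₀ g₀ h₀ ∧
      ∀ h, MinimaxInterpolation.IsOptimal (MinimaxInterpolation.missing s N K) a f₀ g₀ h →
        h =ᵐ[MinimaxInterpolation.freq] h₀) ∧
    ∀ h₀, MinimaxInterpolation.IsOptimal (MinimaxInterpolation.missing s N K) a f₀ g₀ h₀ →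
      (MinimaxInterpolation.IsSolution
          (MinimaxInterpolation.objective (MinimaxInterpolation.missing s N K) a h₀ (Df ×ˢ Dg))
          (f₀, g₀) ↔
        0 ∈ MinimaxInterpolation.subdifferential
          (MinimaxInterpolation.objective (MinimaxInterpolation.missing s N K) a h₀ (Df ×ˢ Dg))
          (f₀, g₀)) ∧
      (MinimaxInterpolation.IsSolution
          (MinimaxInterpolation.objective (MinimaxInterpolation.missing s N K) a h₀ (Df ×ˢ Dg))
          (f₀, g₀) →
        MinimaxInterpolation.IsLeastFavorable
          (MinimaxInterpolation.missing s N K) a (Df ×ˢ Dg) f₀ g₀ ∧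
        (h₀ ∈ MinimaxInterpolation.HD (MinimaxInterpolation.missing s N K) (Df ×ˢ Dg) →
          MinimaxInterpolation.IsMinimax
            (MinimaxInterpolation.missing s N K) a (Df ×ˢ Dg) h₀)) := by
  have hD : ∀ p ∈ Df ×ˢ Dg, MinimaxInterpolation.IsSpectralDensity p.1 ∧
      MinimaxInterpolation.IsSpectralDensity p.2 := fun p hp => ⟨hDf _ hp.1, hDg _ hp.2⟩
  have hmem : (f₀, g₀) ∈ Df ×ˢ Dg := ⟨hf₀, hg₀⟩
  refine ⟨MinimaxInterpolation.exists_unique_isOptimal (hDf _ hf₀) (hDg _ hg₀) hmin,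
    fun h₀ hopt => ⟨MinimaxInterpolation.isSolution_iff_zero_mem_subdifferential, fun h => ⟨?_, ?_⟩⟩⟩
  · exact MinimaxInterpolation.isLeastFavorable_of_isSolution hD hmem hmin hopt h
  · exact MinimaxInterpolation.isMinimax_of_isSolution hmem hopt h
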